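/- Let $(m_j)_{j\ge1}$, $(n_j)_{j\ge 1}$ be given by $m_1=2^5$, $m_{j+1}=m_j^5$, $n_1=2^6$, $n_{j+1}=(2n_j)^{s_j}$, where $2^{s_j}=m_{j+1}^3$. Members $f$ of $c_{00}(\mathbb N)$ act on $c_{00}(\mathbb N)$ by $f(x)=\sum_n f(n)x(n)$. For $K\subset c_{00}(\mathbb N)$ and $j\ge1$, a result of an $(\mathcal A_{n_j},m_j^{-1})$-operation on $K$ is a functional $f=m_j^{-1}(g_1+\dots+g_d)$ with $d\le n_j$, $g_1,\dots,g_d\in K$ and $\operatorname{supp} g_1<\dots<\operatorname{supp} g_d$. We say that $K$ is closed under $\ell_2$-combinations if $\sum_{i=1}^d\lambda_i f_i\in K$ whenever $\lambda_i\in\mathbb Q$, $\sum_i\lambda_i^2\le1$, each $f_i\in K$ is a result of an $(\mathcal A_{n_{j_i}},m_{j_i}^{-1})$-operation on $K$, and the indices $j_i$ are distinct. The set $K$ is rationally convex if it contains all convex combinations with rational coefficients of its members. A ground set is a set $G\subset c_{00}(\mathbb N)$ that is symmetric, contains all $e_n^*$, is closed under restriction of its members to intervals of $\mathbb N$, and whose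 members have rational coefficients in $[-1,1]$. Let $\mathcal W_G$ be the smallest subset of $c_{00}(\mathbb N)$ that contains $G$, is symmetric, closed under restriction to intervals, closed under the $(\mathcal A_{n_j},m_j^{-1})$-operation for every $j\ge1$, closed under $\ell_2$-combinations, and rationally convex. An extension of $G$ is a set $D_G$ with $G\subset D_G\subset\mathcal W_G$ that is symmetric, closed under restriction to intervals, closed under the $(\mathcal A_{n_{2j}},m_{2j}^{-1})$-operation for every $j\ge1$, closed under $\ell_2$-combinations, and rationally convex. Let $X_G$ and $\mathcal Y_{D_G}$ be the completions of $c_{00}(\mathbb N)$ under the norms $\|x\|_G=\sup_{f\in G}f(x)$ and $\|x\|_{D_G}=\sup_{f\in D_G}f(x)$. A Banach space admits $\ell_p$, $1\le p<\infty$ (respectively $c_0$) as a spreading model if it contains a normalized basic sequence $(x_i)_{i\ge1}$ such that, for some $C\ge1$ and every finite $F\subset\mathbb N$ with $\#F\le\min F$, the sequence $(x_i)_{i\in F}$ is $C$-equivalent to the unit vector basis of $\ell_p^{\#F}$ (respectively $\ell_\infty^{\#F}$). Theorem. Let $G$ be a ground set such that $X_G$ does not admit $\ell_1$ as a spreading model.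 Then, for every extension $D_G$ of $G$, the space $\mathcal Y_{D_G}$ does not admit $c_0$ or any $\ell_p$, $1\le p<\infty$, as a spreading model. -/

import Mathlib

noncomputable section

namespace SpreadingModels

/-! ### Sequences of parameters -/

/-- `m_j = 2 ^ (5 ^ j)`, that is `m_1 = 2 ^ 5` and `m_{j+1} = m_j ^ 5`. Only `j ≥ 1` is used. -/
def mSeq (j : ℕ) : ℕ := 2 ^ (5 ^ j)

/-- The exponents `s_j`, determined by `2 ^ s_j = m_{j+1} ^ 3`. -/
def sSeq (j : ℕ) : ℕ := 3 * 5 ^ (j + 1)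

/-- `n_1 = 2 ^ 6` and `n_{j+1} = (2 n_j) ^ s_j` for `j ≥ 1`. The value at `0` is never used. -/
def nSeq : ℕ → ℕ
  | 0 => 1
  | 1 => 2 ^ 6
  | j + 2 => (2 * nSeq (j + 1)) ^ sSeq (j + 1)

theorem mSeq_one : mSeq 1 = 2 ^ 5 := rfl

theorem mSeq_succ (j : ℕ) : mSeq (j + 1) = mSeq j ^ 5 := by
  simp only [mSeq, pow_succ 5 j, pow_mul]

theorem two_pow_sSeq (j : ℕ) : 2 ^ sSeq j = mSeq (j + 1) ^ 3 := by
  rw [sSeq, mSeq, ← pow_mul, mul_comm]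

/-! ### Functionals on `c₀₀` -/

/-- The action `φ(x) = ∑ n, φ(n) x(n)` of `φ ∈ c₀₀` on `x ∈ c₀₀`. -/
def pairing (φ : ℕ →₀ ℝ) : (ℕ →₀ ℝ) →ₗ[ℝ] ℝ := Finsupp.linearCombination ℝ (fun n => φ n)

/-- The restriction of `f` to the interval `{a, …, b}` (empty if `b < a`). -/
def restrictInterval (a b : ℕ) (f : ℕ →₀ ℝ) : ℕ →₀ ℝ := f.filter (fun n => a ≤ n ∧ n ≤ b)

/-- `supp f_1 < supp f_2 < … < supp f_d`. -/
def Successive {d : ℕ} (f : Fin d → ℕ →₀ ℝ) : Prop :=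
  ∀ i k : Fin d, i < k → ∀ a ∈ (f i).support, ∀ b ∈ (f k).support, a < b

/-- `f` is the result of an `(𝒜_{n_j}, m_j⁻¹)`-operation on members of `K`:
`f = m_j⁻¹ (g_1 + ⋯ + g_d)` with `d ≤ n_j`, `g_i ∈ K` and `g_1 < ⋯ < g_d`. -/
def IsOperationResult (K : Set (ℕ →₀ ℝ)) (j : ℕ) (f : ℕ →₀ ℝ) : Prop :=
  ∃ d : ℕ, d ≤ nSeq j ∧ ∃ g : Fin d → ℕ →₀ ℝ,
    (∀ i, g i ∈ K) ∧ Successive g ∧ f = (mSeq j : ℝ)⁻¹ • ∑ i, g i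

/-! ### Closure properties of norming sets -/

def IsSymmetric (K : Set (ℕ →₀ ℝ)) : Prop := ∀ f ∈ K, -f ∈ K

def ClosedUnderIntervals (K : Set (ℕ →₀ ℝ)) : Prop :=
  ∀ f ∈ K, ∀ a b : ℕ, restrictInterval a b f ∈ K

/-- `K` is closed under the `(𝒜_{n_j}, m_j⁻¹)`-operation. -/
def ClosedUnderOperation (K : Set (ℕ →₀ ℝ)) (j : ℕ) : Prop :=
  ∀ f, IsOperationResult K j f → f ∈ K

/-- `K` contains `∑ λ_i f_i` whenever `(λ_i)` are rationals with `∑ λ_i² ≤ 1` and the `f_i` are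
weighted members of `K`, with distinct weights: `f_i ∈ K` is the result of an
`(𝒜_{n_{j_i}}, m_{j_i}⁻¹)`-operation on members of `K`, and the `j_i` (equivalently the `n_{j_i}`,
or the `m_{j_i}`) are distinct. -/
def ClosedUnderL2Combinations (K : Set (ℕ →₀ ℝ)) : Prop :=
  ∀ (d : ℕ) (f : Fin d → ℕ →₀ ℝ) (j : Fin d → ℕ) (c : Fin d → ℚ),
    (∀ i, 1 ≤ j i) → Function.Injective j →
    (∀ i, f i ∈ K ∧ IsOperationResult K (j i) (f i)) →
    ∑ i, c i ^ 2 ≤ 1 → ∑ i, (c i : ℝ) • f i ∈ K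

def RationallyConvex (K : Set (ℕ →₀ ℝ)) : Prop :=
  ∀ (d : ℕ) (f : Fin d → ℕ →₀ ℝ) (r : Fin d → ℚ),
    (∀ i, f i ∈ K) → (∀ i, 0 ≤ r i) → ∑ i, r i = 1 → ∑ i, (r i : ℝ) • f i ∈ K

/-! ### Ground sets and their extensions -/

structure IsGroundSet (G : Set (ℕ →₀ ℝ)) : Prop where
  symm : IsSymmetric G
  basis_mem : ∀ n, Finsupp.single n 1 ∈ G
  abs_le_one : ∀ φ ∈ G, ∀ n, |φ n| ≤ 1
  rational : ∀ φ ∈ G, ∀ n, ∃ q : ℚ, φ n = q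
  interval : ClosedUnderIntervals G

/-- The closure properties that define `𝒲_G`. -/
structure IsFullyClosed (G K : Set (ℕ →₀ ℝ)) : Prop where
  symm : IsSymmetric K
  interval : ClosedUnderIntervals K
  subset : G ⊆ K
  operation : ∀ j, 1 ≤ j → ClosedUnderOperation K j
  l2 : ClosedUnderL2Combinations K
  convex : RationallyConvex K

/-- `𝒲_G`, the smallest subset of `c₀₀` with the properties `IsFullyClosed G`. -/
def fullClosure (G : Set (ℕ →₀ ℝ)) : Set (ℕ →₀ ℝ) := ⋂₀ {K | IsFullyClosed G K}

/-- `D` is an extension of the ground set `G`. -/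
structure IsExtension (G D : Set (ℕ →₀ ℝ)) : Prop where
  subset_fullClosure : D ⊆ fullClosure G
  symm : IsSymmetric D
  interval : ClosedUnderIntervals D
  subset : G ⊆ D
  even_operation : ∀ j, 1 ≤ j → ClosedUnderOperation D (2 * j)
  l2 : ClosedUnderL2Combinations D
  convex : RationallyConvex D

/-! ### The Banach space with norming set `K` -/

/-- The seminorm `‖x‖_K = sup {|φ(x)| : φ ∈ K}` on `c₀₀`. (For a symmetric set `K` of functionals
with coefficients in `[-1, 1]`, see `isLUB_norm`.) -/
def normingSeminorm (K : Set (ℕ →₀ ℝ)) : Seminorm ℝ (ℕ →₀ ℝ) :=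
  ⨆ φ : K, (normSeminorm ℝ ℝ).comp (pairing φ)

/-- `c₀₀`, to be equipped with `‖·‖_K`. -/
def NormedC00 (_K : Set (ℕ →₀ ℝ)) : Type := ℕ →₀ ℝ

instance (K : Set (ℕ →₀ ℝ)) : AddCommGroup (NormedC00 K) :=
  inferInstanceAs (AddCommGroup (ℕ →₀ ℝ))

instance (K : Set (ℕ →₀ ℝ)) : Module ℝ (NormedC00 K) :=
  inferInstanceAs (Module ℝ (ℕ →₀ ℝ))

instance (K : Set (ℕ →₀ ℝ)) : SeminormedAddCommGroup (NormedC00 K) :=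
  fast_instance% (normingSeminorm K).toAddGroupSeminorm.toSeminormedAddCommGroup

instance (K : Set (ℕ →₀ ℝ)) : NormedSpace ℝ (NormedC00 K) where
  norm_smul_le a x := (map_smul_eq_mul (normingSeminorm K) a x).le

/-- The identity map of `c₀₀` onto `(c₀₀, ‖·‖_K)`. -/
def toNormedC00 (K : Set (ℕ →₀ ℝ)) : (ℕ →₀ ℝ) ≃ₗ[ℝ] NormedC00 K := LinearEquiv.refl ℝ (ℕ →₀ ℝ)

/-- The completion of `(c₀₀, ‖·‖_K)`: this is `X_G` for a ground set `K = G`, and `𝒴_{D_G}` for an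
extension `K = D_G`. -/
abbrev NormingSpace (K : Set (ℕ →₀ ℝ)) : Type := UniformSpace.Completion (NormedC00 K)

theorem pairing_apply (φ x : ℕ →₀ ℝ) : pairing φ x = ∑ n ∈ x.support, x n * φ n := by
  simp [pairing, Finsupp.linearCombination_apply, Finsupp.sum]

theorem pairing_neg (φ x : ℕ →₀ ℝ) : pairing (-φ) x = -pairing φ x := by
  simp [pairing_apply]

theorem abs_pairing_le {φ : ℕ →₀ ℝ} (h : ∀ n, |φ n| ≤ 1) (x : ℕ →₀ ℝ) :
    |pairing φ x| ≤ ∑ n ∈ x.support, |x n| := by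
  rw [pairing_apply]
  refine (Finset.abs_sum_le_sum_abs _ _).trans (Finset.sum_le_sum fun n _ => ?_)
  rw [abs_mul]
  exact mul_le_of_le_one_right (abs_nonneg _) (h n)

/-- `‖x‖_K = sup {φ(x) : φ ∈ K}` for a nonempty symmetric set `K` of functionals with coefficients
in `[-1, 1]`. -/
theorem isLUB_norm {K : Set (ℕ →₀ ℝ)} (hne : K.Nonempty) (hs : IsSymmetric K)
    (hb : ∀ φ ∈ K, ∀ n, |φ n| ≤ 1) (x : ℕ →₀ ℝ) :
    IsLUB {t | ∃ φ ∈ K, t = pairing φ x} ‖toNormedC00 K x‖ := by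
  have hbdd : BddAbove (Set.range fun φ : K => (normSeminorm ℝ ℝ).comp (pairing φ)) := by
    rw [Seminorm.bddAbove_range_iff]
    rintro y
    refine ⟨∑ n ∈ y.support, |y n|, ?_⟩
    rintro _ ⟨φ, rfl⟩
    exact abs_pairing_le (hb φ φ.2) y
  have hx : ‖toNormedC00 K x‖ = ⨆ φ : K, |pairing φ x| := Seminorm.iSup_apply hbdd
  have hbx : BddAbove (Set.range fun φ : K => |pairing φ x|) :=
    ⟨∑ n ∈ x.support, |x n|, by rintro _ ⟨φ, rfl⟩; exact abs_pairing_le (hb φ φ.2) x⟩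
  rw [hx]
  constructor
  · rintro _ ⟨φ, hφ, rfl⟩
    exact (le_abs_self _).trans (le_ciSup hbx ⟨φ, hφ⟩)
  · intro t ht
    have : Nonempty K := hne.to_subtype
    refine ciSup_le fun φ => abs_le'.2 ⟨ht ⟨φ, φ.2, rfl⟩, ht ⟨-φ, hs _ φ.2, ?_⟩⟩
    exact (pairing_neg _ _).symm

theorem IsGroundSet.isLUB_norm {G : Set (ℕ →₀ ℝ)} (hG : IsGroundSet G) (x : ℕ →₀ ℝ) :
    IsLUB {t | ∃ φ ∈ G, t = pairing φ x} ‖toNormedC00 G x‖ :=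
  SpreadingModels.isLUB_norm ⟨_, hG.basis_mem 0⟩ hG.symm hG.abs_le_one x

theorem abs_operationResult_le {K : Set (ℕ →₀ ℝ)} (hK : ∀ f ∈ K, ∀ n, |f n| ≤ 1) {j : ℕ}
    {f : ℕ →₀ ℝ} (hf : IsOperationResult K j f) (n : ℕ) : |f n| ≤ (mSeq j : ℝ)⁻¹ := by
  obtain ⟨d, -, g, hg, hs, rfl⟩ := hf
  have key : |∑ i, g i n| ≤ 1 := by
    by_cases h : ∃ i, g i n ≠ 0
    · obtain ⟨i, hi⟩ := h
      rw [Finset.sum_eq_single i]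
      · exact hK _ (hg i) n
      · intro k _ hki
        by_contra hk
        rcases lt_or_gt_of_ne hki with h | h
        · exact lt_irrefl n (hs k i h n (by simpa using hk) n (by simpa using hi))
        · exact lt_irrefl n (hs i k h n (by simpa using hi) n (by simpa using hk))
      · simp
    · push Not at h
      simp [h]
  simp only [Finsupp.smul_apply, Finsupp.finsetSum_apply, smul_eq_mul, abs_mul]
  rw [abs_of_nonneg (by positivity)]
  exact mul_le_of_le_one_right (by positivity) key

theorem inv_mSeq_le (j : ℕ) : (mSeq j : ℝ)⁻¹ ≤ (1 / 2) ^ (j + 1) := by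
  have h : j + 1 ≤ 5 ^ j := Nat.lt_pow_self (by norm_num)
  rw [mSeq, one_div, inv_pow]
  push_cast
  exact inv_anti₀ (by positivity) (pow_le_pow_right₀ (by norm_num) h)

/-- The functionals in `𝒲_G` have coefficients in `[-1, 1]`, so that `‖·‖_K` is finite for
`K ⊆ 𝒲_G`. -/
theorem IsGroundSet.abs_le_one_of_mem_fullClosure {G : Set (ℕ →₀ ℝ)} (hG : IsGroundSet G) :
    ∀ f ∈ fullClosure G, ∀ n, |f n| ≤ 1 := by
  have hcl : IsFullyClosed G {f | ∀ n, |f n| ≤ 1} := by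
    refine ⟨fun f hf n => by simpa using hf n, fun f hf a b n => ?_, hG.abs_le_one,
      fun j _ f hf n => ?_, fun d f j c _ hj hf hc n => ?_, fun d f r hf hr hsum n => ?_⟩
    · by_cases h : a ≤ n ∧ n ≤ b
      · simpa [restrictInterval, Finsupp.filter_apply, h] using hf n
      · simp [restrictInterval, h]
    · refine (abs_operationResult_le (fun _ h => h) hf n).trans ((inv_mSeq_le j).trans ?_)
      exact pow_le_one₀ (by norm_num) (by norm_num)
    · have hc1 : ∀ i, |(c i : ℝ)| ≤ 1 := by
        intro i
        have h1 : c i ^ 2 ≤ 1 :=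
          (Finset.single_le_sum (f := fun i => c i ^ 2) (fun i _ => sq_nonneg _)
            (Finset.mem_univ i)).trans hc
        have h2 : |c i| ≤ 1 := by rwa [sq_le_one_iff_abs_le_one] at h1
        exact_mod_cast h2
      have hsm : Summable fun k : ℕ => ((1 : ℝ) / 2) ^ (k + 1) := by
        simpa [pow_succ] using summable_geometric_two.mul_right ((1 : ℝ) / 2)
      calc |(∑ i, (c i : ℝ) • f i) n| = |∑ i, (c i : ℝ) * f i n| := by
            simp [Finsupp.finsetSum_apply]
        _ ≤ ∑ i, |(c i : ℝ) * f i n| := Finset.abs_sum_le_sum_abs _ _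
        _ ≤ ∑ i, ((1 : ℝ) / 2) ^ (j i + 1) := by
            refine Finset.sum_le_sum fun i _ => ?_
            rw [abs_mul]
            exact (mul_le_of_le_one_left (abs_nonneg _) (hc1 i)).trans
              ((abs_operationResult_le (fun _ h => h) (hf i).2 n).trans (inv_mSeq_le _))
        _ = ∑ k ∈ Finset.univ.map ⟨j, hj⟩, ((1 : ℝ) / 2) ^ (k + 1) := by simp
        _ ≤ ∑' k : ℕ, ((1 : ℝ) / 2) ^ (k + 1) :=
            hsm.sum_le_tsum _ fun _ _ => by positivity
        _ = 1 := by
            simp only [pow_succ]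
            rw [tsum_mul_right, tsum_geometric_two]
            norm_num
    · calc |(∑ i, (r i : ℝ) • f i) n| = |∑ i, (r i : ℝ) * f i n| := by
            simp [Finsupp.finsetSum_apply]
        _ ≤ ∑ i, |(r i : ℝ) * f i n| := Finset.abs_sum_le_sum_abs _ _
        _ ≤ ∑ i, (r i : ℝ) := by
            refine Finset.sum_le_sum fun i _ => ?_
            rw [abs_mul, abs_of_nonneg (by exact_mod_cast hr i)]
            exact mul_le_of_le_one_right (by exact_mod_cast hr i) (hf i n)
        _ = 1 := by exact_mod_cast hsum
  exact fun f hf => hf _ hcl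

theorem IsExtension.isLUB_norm {G D : Set (ℕ →₀ ℝ)} (hG : IsGroundSet G) (hD : IsExtension G D)
    (x : ℕ →₀ ℝ) : IsLUB {t | ∃ φ ∈ D, t = pairing φ x} ‖toNormedC00 D x‖ :=
  SpreadingModels.isLUB_norm ⟨_, hD.subset (hG.basis_mem 0)⟩ hD.symm
    (fun f hf => hG.abs_le_one_of_mem_fullClosure f (hD.subset_fullClosure hf)) x

/-! ### Spreading models -/

/-- A basic sequence: a Schauder basis of its closed linear span. -/
def IsBasicSequence {E : Type*} [NormedAddCommGroup E] [NormedSpace ℝ E] (x : ℕ → E) : Prop :=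
  ∃ b : SchauderBasis ℝ (Submodule.span ℝ (Set.range x)).topologicalClosure,
    ∀ n, (b n : E) = x n

/-- The Schreier family `𝒮_1` of the sets `F` with `#F ≤ min F`. As sequences are indexed here from
`0`, the index `i` stands for the `(i + 1)`-st term. -/
def schreier : Set (Finset ℕ) := {F | ∀ i ∈ F, F.card ≤ i + 1}

/-- The normalized basic sequence `(x_i)` generates an `ℓ_p`-spreading model (a `c₀`-spreading model
if `p = ∞`): for some `C ≥ 1` and all `F ∈ 𝒮_1`, the sequence `(x_i)_{i ∈ F}` is `C`-equivalent to
the unit vector basis of `ℓ_p^{#F}`. -/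
def GeneratesSpreadingModel {E : Type*} [NormedAddCommGroup E] [NormedSpace ℝ E]
    (p : ENNReal) (x : ℕ → E) : Prop :=
  (∀ i, ‖x i‖ = 1) ∧ IsBasicSequence x ∧
    ∃ C : ℝ, 1 ≤ C ∧ ∀ F ∈ schreier, ∀ a : F → ℝ,
      C⁻¹ * ‖WithLp.toLp p a‖ ≤ ‖∑ i, a i • x i‖ ∧ ‖∑ i, a i • x i‖ ≤ C * ‖WithLp.toLp p a‖

/-- `E` admits `ℓ_p` as a spreading model, `1 ≤ p < ∞`. -/
def AdmitsEllSpreadingModel (E : Type*) [NormedAddCommGroup E] [NormedSpace ℝ E]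
    (p : ENNReal) : Prop :=
  ∃ x : ℕ → E, GeneratesSpreadingModel p x

/-- `E` admits `c₀` as a spreading model. -/
def AdmitsC0SpreadingModel (E : Type*) [NormedAddCommGroup E] [NormedSpace ℝ E] : Prop :=
  ∃ x : ℕ → E, GeneratesSpreadingModel ⊤ x

end SpreadingModels

end

noncomputable section

namespace SpreadingModels

/-! ### The norming seminorm -/

/-! An extension is closed under the odd operations as well (`closedUnderOperation_of_succ`), so it
is fully closed and, lying inside `fullClosure G`, has its minimality. Differences of a sequence
generating a spreading model are, up to summable errors, a block sequence
(`exists_blockSequence_near_differences`), so block sequences are what has to be studied.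

For `c₀` and for `p > 1`, functionals norming `n_j` blocks are glued by one operation. The sum of
the blocks then has norm at least of order `n_j / m_j`, while the spreading model allows only order
`n_j ^ (1/p)`. This is impossible for large `j`, since `n_j` outgrows every fixed power of `m_j`.

For `p = 1`, take blocks bounded by `C` with a lower `ℓ_1` estimate on Schreier sets. Combinations
of bounded length with `∑ |a_k| = 1` keep the estimate with the same constant
(`LowerEllOne.exists_blocks`), so it suffices to halve `C` again and again. As `X_G` has no `ℓ_1`
spreading model, combinations exist whose `G`-norm is at most `C / 2` (`exists_small_combination`).
Averaging these halves the full norm (`exists_average_le`). By minimality only `G` and the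
`ℓ_2`-combinations of weighted functionals need be tested. Finitely many low indices are harmless on
long averages: a functional of index `j` splits at most `n_j` blocks and gains `m_j⁻¹` on the
others. For the high indices, the norms given by the separate indices form a vector of `ℓ_2` of
length at most `‖x‖` (`sum_sq_weightedNorm_le`), and bounded vectors of `ℓ_2` have almost orthogonal
tails along a subsequence (`exists_almost_orthogonal`), so their averages are small there. -/

theorem normingSeminorm_apply {K : Set (ℕ →₀ ℝ)} (hb : ∀ φ ∈ K, ∀ n, |φ n| ≤ 1) (x : ℕ →₀ ℝ) :
    normingSeminorm K x = ⨆ φ : K, |pairing φ x| := by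
  refine Seminorm.iSup_apply ?_
  rw [Seminorm.bddAbove_range_iff]
  intro y
  refine ⟨∑ n ∈ y.support, |y n|, ?_⟩
  rintro _ ⟨φ, rfl⟩
  exact abs_pairing_le (hb φ φ.2) y

theorem abs_pairing_le_normingSeminorm {K : Set (ℕ →₀ ℝ)} (hb : ∀ φ ∈ K, ∀ n, |φ n| ≤ 1)
    {φ : ℕ →₀ ℝ} (hφ : φ ∈ K) (x : ℕ →₀ ℝ) : |pairing φ x| ≤ normingSeminorm K x := by
  rw [normingSeminorm_apply hb]
  refine le_ciSup (f := fun φ : K => |pairing φ x|) ⟨∑ n ∈ x.support, |x n|, ?_⟩ ⟨φ, hφ⟩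
  rintro _ ⟨φ, rfl⟩
  exact abs_pairing_le (hb φ φ.2) x

theorem normingSeminorm_le {K : Set (ℕ →₀ ℝ)} (hb : ∀ φ ∈ K, ∀ n, |φ n| ≤ 1) {x : ℕ →₀ ℝ} {B : ℝ}
    (hB : 0 ≤ B) (h : ∀ φ ∈ K, |pairing φ x| ≤ B) : normingSeminorm K x ≤ B := by
  rw [normingSeminorm_apply hb]
  exact Real.iSup_le (fun φ => h φ φ.2) hB

theorem exists_lt_abs_pairing {K : Set (ℕ →₀ ℝ)} (hb : ∀ φ ∈ K, ∀ n, |φ n| ≤ 1) {x : ℕ →₀ ℝ} {B : ℝ}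
    (hB : 0 ≤ B) (h : B < normingSeminorm K x) : ∃ φ ∈ K, B < |pairing φ x| := by
  by_contra! hc
  exact absurd (normingSeminorm_le hb hB hc) (not_le.2 h)

theorem normingSeminorm_mono {K L : Set (ℕ →₀ ℝ)} (hb : ∀ φ ∈ L, ∀ n, |φ n| ≤ 1) (h : K ⊆ L)
    (x : ℕ →₀ ℝ) : normingSeminorm K x ≤ normingSeminorm L x :=
  normingSeminorm_le (fun φ hφ => hb φ (h hφ)) (apply_nonneg _ _)
    fun _ hφ => abs_pairing_le_normingSeminorm hb (h hφ) x

theorem norm_toNormedC00 (K : Set (ℕ →₀ ℝ)) (x : ℕ →₀ ℝ) :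
    ‖toNormedC00 K x‖ = normingSeminorm K x := rfl

theorem pairing_comm (φ x : ℕ →₀ ℝ) : pairing φ x = pairing x φ := by
  have h : ∀ φ x : ℕ →₀ ℝ, pairing φ x = ∑ n ∈ φ.support ∪ x.support, x n * φ n := by
    intro φ x
    rw [pairing_apply]
    exact Finset.sum_subset Finset.subset_union_right fun n _ hn => by
      simp [Finsupp.notMem_support_iff.1 hn]
  rw [h, h, Finset.union_comm]
  exact Finset.sum_congr rfl fun n _ => mul_comm _ _

theorem pairing_sum_smul {ι : Type*} (s : Finset ι) (c : ι → ℝ) (f : ι → ℕ →₀ ℝ) (x : ℕ →₀ ℝ) :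
    pairing (∑ i ∈ s, c i • f i) x = ∑ i ∈ s, c i * pairing (f i) x := by
  rw [pairing_comm, map_sum]
  exact Finset.sum_congr rfl fun i _ => by rw [map_smul, pairing_comm, smul_eq_mul]

theorem pairing_sum {ι : Type*} (s : Finset ι) (f : ι → ℕ →₀ ℝ) (x : ℕ →₀ ℝ) :
    pairing (∑ i ∈ s, f i) x = ∑ i ∈ s, pairing (f i) x := by
  simpa using pairing_sum_smul s (fun _ => 1) f x

theorem pairing_smul (c : ℝ) (f x : ℕ →₀ ℝ) : pairing (c • f) x = c * pairing f x := by
  rw [pairing_comm, map_smul, pairing_comm, smul_eq_mul]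

theorem pairing_filter (p : ℕ → Prop) [DecidablePred p] (φ x : ℕ →₀ ℝ) :
    pairing (φ.filter p) x = pairing φ (x.filter p) := by
  rw [pairing_apply, pairing_apply, Finsupp.support_filter, Finset.sum_filter]
  refine Finset.sum_congr rfl fun n _ => ?_
  by_cases h : p n <;> simp [h]

theorem pairing_eq_zero_of_disjoint {φ x : ℕ →₀ ℝ} (h : Disjoint φ.support x.support) :
    pairing φ x = 0 := by
  rw [pairing_apply]
  refine Finset.sum_eq_zero fun n hn => ?_
  rw [Finsupp.notMem_support_iff.1 (Finset.disjoint_right.1 h hn), mul_zero]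

theorem abs_apply_le_normingSeminorm {K : Set (ℕ →₀ ℝ)} (hb : ∀ φ ∈ K, ∀ n, |φ n| ≤ 1) {n : ℕ}
    (hn : Finsupp.single n 1 ∈ K) (x : ℕ →₀ ℝ) : |x n| ≤ normingSeminorm K x := by
  have h := abs_pairing_le_normingSeminorm hb hn x
  rwa [pairing_comm, pairing, Finsupp.linearCombination_single, one_smul] at h

theorem normingSeminorm_single_le {K : Set (ℕ →₀ ℝ)} (hb : ∀ φ ∈ K, ∀ n, |φ n| ≤ 1) (n : ℕ)
    (c : ℝ) : normingSeminorm K (Finsupp.single n c) ≤ |c| := by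
  refine normingSeminorm_le hb (abs_nonneg _) fun φ hφ => ?_
  rw [pairing, Finsupp.linearCombination_single, smul_eq_mul, abs_mul]
  exact mul_le_of_le_one_right (abs_nonneg _) (hb φ hφ n)

theorem filter_lt_mem {K : Set (ℕ →₀ ℝ)} (hK : ClosedUnderIntervals K) {f : ℕ →₀ ℝ} (hf : f ∈ K)
    (N : ℕ) : f.filter (· < N) ∈ K := by
  rcases N with _ | N
  -- The interval from `1` to `0` is empty.
  · convert hK f hf 1 0 using 1
    ext n
    simp only [restrictInterval, Finsupp.filter_apply]
    rw [if_neg (by lia), if_neg (by lia)]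
  · convert hK f hf 0 N using 1
    ext n
    simp only [restrictInterval, Finsupp.filter_apply]
    exact if_congr (by lia) rfl rfl

theorem normingSeminorm_filter_lt_le {K : Set (ℕ →₀ ℝ)} (hb : ∀ φ ∈ K, ∀ n, |φ n| ≤ 1)
    (hK : ClosedUnderIntervals K) (N : ℕ) (x : ℕ →₀ ℝ) :
    normingSeminorm K (x.filter (· < N)) ≤ normingSeminorm K x := by
  refine normingSeminorm_le hb (apply_nonneg _ _) fun φ hφ => ?_
  rw [← pairing_filter]
  exact abs_pairing_le_normingSeminorm hb (filter_lt_mem hK hφ N) x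

/-! ### Every extension is closed under all operations -/

theorem zero_mem_of_l2 {K : Set (ℕ →₀ ℝ)} (hK : ClosedUnderL2Combinations K) : 0 ∈ K := by
  simpa using hK 0 Fin.elim0 Fin.elim0 Fin.elim0 (fun i => i.elim0) (fun i => i.elim0)
    (fun i => i.elim0) (by simp)

theorem RationallyConvex.smul_mem {K : Set (ℕ →₀ ℝ)} (hK : RationallyConvex K) (h0 : 0 ∈ K)
    {f : ℕ →₀ ℝ} (hf : f ∈ K) {r : ℚ} (hr : 0 ≤ r) (hr1 : r ≤ 1) : (r : ℝ) • f ∈ K := by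
  have := hK 2 ![f, 0] ![r, 1 - r] (by intro i; fin_cases i <;> simpa)
    (by intro i; fin_cases i <;> simp [hr, hr1]) (by simp)
  simpa [Fin.sum_univ_two] using this

theorem nSeq_le_succ {j : ℕ} (hj : 1 ≤ j) : nSeq j ≤ nSeq (j + 1) := by
  obtain ⟨i, rfl⟩ := Nat.exists_eq_add_of_le' hj
  show nSeq (i + 1) ≤ (2 * nSeq (i + 1)) ^ sSeq (i + 1)
  exact (Nat.le_mul_of_pos_left _ two_pos).trans
    (Nat.le_self_pow (by simp [sSeq]) _)

theorem l2_pair_mem {K : Set (ℕ →₀ ℝ)} (hK : ClosedUnderL2Combinations K) {f g : ℕ →₀ ℝ}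
    {i j : ℕ} (hi : 1 ≤ i) (hj : 1 ≤ j) (hij : i ≠ j) (hf : f ∈ K) (hf' : IsOperationResult K i f)
    (hg : g ∈ K) (hg' : IsOperationResult K j g) {a b : ℚ} (hab : a ^ 2 + b ^ 2 ≤ 1) :
    (a : ℝ) • f + (b : ℝ) • g ∈ K := by
  have := hK 2 ![f, g] ![i, j] ![a, b] (by intro k; fin_cases k <;> simpa)
    (by
      intro k l h
      fin_cases k <;> fin_cases l <;> simp_all)
    (by intro k; fin_cases k <;> simp [*]) (by simpa [Fin.sum_univ_two])
  simpa [Fin.sum_univ_two] using this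

/-- A multiple `t (g_1 + ⋯ + g_d)` with `t ≤ m_j⁻¹` is also a result of an operation with index `j`.
Combining it in `ℓ_2` with a result of index `j + 1` makes `t` grow until it reaches `m_j⁻¹`. -/
theorem closedUnderOperation_of_succ {K : Set (ℕ →₀ ℝ)} (hl2 : ClosedUnderL2Combinations K)
    (hconv : RationallyConvex K) {j : ℕ} (hj : 1 ≤ j) (hop : ClosedUnderOperation K (j + 1)) :
    ClosedUnderOperation K j := by
  rintro _ ⟨d, hd, g, hg, hs, rfl⟩
  have h0 := zero_mem_of_l2 hl2
  set S := ∑ i, g i with hS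
  set p : ℚ := (mSeq j : ℚ)⁻¹ with hp
  set q : ℚ := (mSeq (j + 1) : ℚ)⁻¹ with hq
  have hmpos : ∀ k, (0 : ℚ) < mSeq k := fun k => by simp [mSeq]
  have hp0 : 0 < p := inv_pos.2 (hmpos _)
  have hq0 : 0 < q := inv_pos.2 (hmpos _)
  have hqp : q ≤ p := inv_anti₀ (hmpos _) <| by
    rw [mSeq_succ]
    exact_mod_cast Nat.le_self_pow (by norm_num) _
  have hqS : IsOperationResult K (j + 1) ((q : ℝ) • S) :=
    ⟨d, hd.trans (nSeq_le_succ hj), g, hg, hs, by simp [hq, hS]⟩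
  have hqK := hop _ hqS
  set A : Set ℚ := {t | (t : ℝ) • S ∈ K}
  have down : ∀ t ∈ A, 0 < t → ∀ u, 0 ≤ u → u ≤ t → u ∈ A := by
    intro t ht ht0 u hu hut
    have := hconv.smul_mem h0 ht (div_nonneg hu ht0.le) ((div_le_one ht0).2 hut)
    rw [smul_smul, ← Rat.cast_mul, div_mul_cancel₀ _ ht0.ne'] at this
    exact this
  -- This is `p s²` for the `s = q / (2p)` used below. It does not depend on `t`, so finitely many
  -- steps reach `p`.
  set δ : ℚ := q ^ 2 / (4 * p) with hδ
  have hδ0 : 0 < δ := by positivity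
  have grow : ∀ t ∈ A, 0 < t → t ≤ p → t + δ ∈ A := by
    intro t ht ht0 htp
    -- Since `t m_j ≤ 1`, the factor `t m_j` can be absorbed into the `g_i`, which stay in `K` by
    -- convexity with `0`.
    have htS : IsOperationResult K j ((t : ℝ) • S) := by
      refine ⟨d, hd, fun i => ((t * mSeq j : ℚ) : ℝ) • g i, fun i => ?_, fun i k hik a ha b hb => ?_,
        ?_⟩
      · refine hconv.smul_mem h0 (hg i) (mul_nonneg ht0.le (hmpos j).le) ?_
        calc t * mSeq j ≤ p * mSeq j := by gcongr
          _ = 1 := inv_mul_cancel₀ (hmpos j).ne'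
      · exact hs i k hik a (Finsupp.support_smul ha) b (Finsupp.support_smul hb)
      · rw [← Finset.smul_sum, smul_smul]
        congr 1
        have : (mSeq j : ℝ) ≠ 0 := by exact_mod_cast (hmpos j).ne'
        push_cast
        field_simp
    obtain ⟨s, hsdef⟩ : ∃ s : ℚ, s = q / (2 * p) := ⟨_, rfl⟩
    have hs0 : 0 < s := by rw [hsdef]; positivity
    have hs1 : s ≤ 1 := by rw [hsdef, div_le_one (by positivity)]; linarith
    have hs2 : 0 < 1 + s ^ 2 := by positivity
    -- The rational parametrization of the circle: tilting slightly towards `q S` costs second order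
    -- in `s` and, as `q = 2 p s`, gains more than it costs.
    have hab : ((1 - s ^ 2) / (1 + s ^ 2)) ^ 2 + (2 * s / (1 + s ^ 2)) ^ 2 ≤ 1 := by
      rw [div_pow, div_pow, ← add_div, div_le_one (by positivity)]
      exact le_of_eq (by ring)
    have hmem := l2_pair_mem hl2 hj (Nat.le_add_left 1 j) (Nat.lt_succ_self j).ne ht htS hqK
      hqS hab
    rw [smul_smul, smul_smul, ← add_smul, ← Rat.cast_mul, ← Rat.cast_mul, ← Rat.cast_add] at hmem
    have hle : t + δ ≤ (1 - s ^ 2) / (1 + s ^ 2) * t + 2 * s / (1 + s ^ 2) * q := by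
      have hqs : q = 2 * p * s := by rw [hsdef]; field_simp
      have hδs : δ = p * s ^ 2 := by rw [hδ, hqs]; field_simp; ring
      rw [div_mul_eq_mul_div, div_mul_eq_mul_div, ← add_div, le_div_iff₀ hs2, hδs, hqs]
      have h1 : 0 ≤ s ^ 2 * (p - t) := mul_nonneg (sq_nonneg _) (by linarith)
      have h2 : 0 ≤ p * s ^ 2 * (1 - s ^ 2) :=
        mul_nonneg (by positivity) (by nlinarith)
      nlinarith
    exact down _ hmem (by linarith) _ (by linarith) hle
  have step : ∀ k : ℕ, min p (q + k * δ) ∈ A := by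
    intro k
    induction k with
    | zero =>
      have hqA : q ∈ A := hqK
      simpa [min_eq_right hqp] using hqA
    | succ k ih =>
      have hpos : 0 < min p (q + k * δ) := lt_min hp0 (by positivity)
      have := grow _ ih hpos (min_le_left _ _)
      refine down _ this (by linarith) _ (le_min hp0.le (by positivity)) ?_
      rcases min_cases p (q + k * δ) with ⟨h, -⟩ | ⟨h, -⟩ <;> rw [h]
      · exact (min_le_left _ _).trans (by linarith)
      · refine (min_le_right _ _).trans (le_of_eq ?_)
        push_cast
        ring
  obtain ⟨k, hk⟩ := exists_nat_ge (p / δ)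
  have h := step k
  rw [min_eq_left (by rw [div_le_iff₀ hδ0] at hk; linarith)] at h
  simpa [A, hp] using h

theorem IsExtension.isFullyClosed {G D : Set (ℕ →₀ ℝ)} (hD : IsExtension G D) :
    IsFullyClosed G D where
  symm := hD.symm
  interval := hD.interval
  subset := hD.subset
  operation j hj := by
    rcases Nat.even_or_odd' j with ⟨k, rfl | rfl⟩
    · exact hD.even_operation k (by lia)
    · exact closedUnderOperation_of_succ hD.l2 hD.convex hj (hD.even_operation (k + 1) (by lia))
  l2 := hD.l2
  convex := hD.convex

/-! ### Block sequences are basic -/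

-- The coordinate functionals are `g_k ∘ (P_{k+1} - P_k)` with `g_k (u_k) = 1`. On the closed span
-- the partial sums of the expansion are then the `P_n`. They are eventually the identity on each
-- vector of the span, and the uniform bound carries the convergence to the closure.
open Filter Topology in
theorem isBasicSequence_of_projections {E : Type*} [NormedAddCommGroup E] [NormedSpace ℝ E]
    {u : ℕ → E} (hu : ∀ k, u k ≠ 0) (P : ℕ → E →L[ℝ] E) (hP : ∀ n x, ‖P n x‖ ≤ ‖x‖)
    (hPu : ∀ n k, P n (u k) = if k < n then u k else 0) : IsBasicSequence u := by
  have hdual : ∀ k, ∃ g : StrongDual ℝ E, g (u k) = 1 := fun k => by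
    obtain ⟨g, -, hg⟩ := exists_dual_vector ℝ (u k) (norm_ne_zero_iff.2 (hu k))
    refine ⟨‖u k‖⁻¹ • g, ?_⟩
    have : ‖u k‖ ≠ 0 := norm_ne_zero_iff.2 (hu k)
    simp [hg, this]
  choose g hg using hdual
  set V := (Submodule.span ℝ (Set.range u)).topologicalClosure with hV
  have huV : ∀ k, u k ∈ V := fun k =>
    Submodule.le_topologicalClosure _ (Submodule.subset_span ⟨k, rfl⟩)
  set co : ℕ → StrongDual ℝ E := fun k => (g k).comp (P (k + 1) - P k) with hco
  have hcou : ∀ i j, co i (u j) = if i = j then 1 else 0 := by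
    intro i j
    simp only [hco, ContinuousLinearMap.comp_apply, _root_.sub_apply, hPu]
    rcases lt_trichotomy i j with h | rfl | h
    · rw [if_neg (by lia), if_neg (by lia), if_neg (by lia)]; simp
    · simp [hg]
    · rw [if_pos (by lia), if_pos (by lia), if_neg (by lia)]; simp
  have hsum : ∀ n, ∀ x ∈ V, ∑ k ∈ Finset.range n, co k x • u k = P n x := by
    intro n
    have h1 : ∀ x ∈ Submodule.span ℝ (Set.range u),
        ∑ k ∈ Finset.range n, co k x • u k = P n x := by
      intro x hx
      induction hx using Submodule.span_induction with
      | mem x hx =>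
        obtain ⟨j, rfl⟩ := hx
        simp [hcou, hPu]
      | zero => simp
      | add x y _ _ hx hy => simp only [map_add, add_smul, Finset.sum_add_distrib, hx, hy]
      | smul a x _ hx => simp only [map_smul, smul_eq_mul, mul_smul, ← Finset.smul_sum, hx]
    intro x hx
    have hcl : IsClosed {x : E | ∑ k ∈ Finset.range n, co k x • u k = P n x} :=
      isClosed_eq (by fun_prop) (by fun_prop)
    exact closure_minimal (fun y hy => h1 y hy) hcl hx
  have hev : ∀ x ∈ Submodule.span ℝ (Set.range u), ∀ᶠ n in atTop, P n x = x := by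
    intro x hx
    induction hx using Submodule.span_induction with
    | mem x hx =>
      obtain ⟨j, rfl⟩ := hx
      filter_upwards [eventually_gt_atTop j] with n hn
      rw [hPu, if_pos hn]
    | zero => simp
    | add x y _ _ hx hy =>
      filter_upwards [hx, hy] with n h1 h2
      rw [map_add, h1, h2]
    | smul a x _ hx =>
      filter_upwards [hx] with n h1
      rw [map_smul, h1]
  have hlim : ∀ x ∈ V, Tendsto (fun n => P n x) atTop (𝓝 x) := by
    intro x hx
    rw [Metric.tendsto_atTop']
    intro ε hε
    obtain ⟨y, hy, hxy⟩ := Metric.mem_closure_iff.1 hx (ε / 2) (half_pos hε)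
    obtain ⟨N, hN⟩ := eventually_atTop.1 (hev y hy)
    refine ⟨N, fun n hn => ?_⟩
    have h1 : ‖P n (x - y)‖ ≤ ‖x - y‖ := hP n _
    rw [map_sub, hN n hn.le] at h1
    rw [dist_eq_norm] at hxy ⊢
    calc ‖P n x - x‖ = ‖(P n x - y) - (x - y)‖ := by congr 1; abel
      _ ≤ ‖P n x - y‖ + ‖x - y‖ := norm_sub_le _ _
      _ < ε := by linarith
  refine ⟨⟨fun k => ⟨u k, huV k⟩, fun k => (co k).comp V.subtypeL, fun i j => ?_, fun x => ?_⟩,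
    fun n => rfl⟩
  · simp [hcou, Pi.single_apply]
  · rw [HasSum, SummationFilter.conditional_filter_eq_map_range, tendsto_map'_iff,
      tendsto_subtype_rng]
    refine (hlim x x.2).congr fun n => ?_
    simp [← hsum n x x.2]

/-- The map of `c₀₀` into its completion under `‖·‖_K`. -/
def toNormingSpace (K : Set (ℕ →₀ ℝ)) : (ℕ →₀ ℝ) →ₗ[ℝ] NormingSpace K :=
  (UniformSpace.Completion.toComplₗᵢ (𝕜 := ℝ) (E := NormedC00 K)).toLinearMap ∘ₗ
    (toNormedC00 K).toLinearMap

theorem norm_toNormingSpace (K : Set (ℕ →₀ ℝ)) (x : ℕ →₀ ℝ) :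
    ‖toNormingSpace K x‖ = normingSeminorm K x :=
  (UniformSpace.Completion.norm_coe (toNormedC00 K x)).trans (norm_toNormedC00 K x)

theorem exists_toNormingSpace_near (K : Set (ℕ →₀ ℝ)) (x : NormingSpace K) {ε : ℝ} (hε : 0 < ε) :
    ∃ y, ‖toNormingSpace K y - x‖ ≤ ε := by
  obtain ⟨y, hy⟩ := (UniformSpace.Completion.denseRange_coe (α := NormedC00 K)).exists_dist_lt x hε
  refine ⟨(toNormedC00 K).symm y, ?_⟩
  rw [dist_comm, dist_eq_norm] at hy
  exact hy.le

/-- The projection of `(c₀₀, ‖·‖_K)` onto the first `N` coordinates. -/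
def truncation {K : Set (ℕ →₀ ℝ)} (hb : ∀ φ ∈ K, ∀ n, |φ n| ≤ 1) (hK : ClosedUnderIntervals K)
    (N : ℕ) : NormedC00 K →L[ℝ] NormedC00 K :=
  LinearMap.mkContinuous
    { toFun := fun x => toNormedC00 K (((toNormedC00 K).symm x).filter (· < N))
      map_add' := fun x y => by simp [Finsupp.filter_add]
      map_smul' := fun c x => by simp [Finsupp.filter_smul] } 1 fun x => by
    rw [one_mul]
    exact normingSeminorm_filter_lt_le hb hK N ((toNormedC00 K).symm x)

theorem norm_completion_truncation_le {K : Set (ℕ →₀ ℝ)} (hb : ∀ φ ∈ K, ∀ n, |φ n| ≤ 1)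
    (hK : ClosedUnderIntervals K) (N : ℕ) (x : NormingSpace K) :
    ‖(truncation hb hK N).completion x‖ ≤ ‖x‖ := by
  induction x using UniformSpace.Completion.induction_on with
  | hp => exact isClosed_le (by fun_prop) (by fun_prop)
  | ih x =>
    rw [ContinuousLinearMap.completion_apply_coe, UniformSpace.Completion.norm_coe,
      UniformSpace.Completion.norm_coe]
    exact normingSeminorm_filter_lt_le hb hK N ((toNormedC00 K).symm x)

theorem completion_truncation_toNormingSpace {K : Set (ℕ →₀ ℝ)} (hb : ∀ φ ∈ K, ∀ n, |φ n| ≤ 1)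
    (hK : ClosedUnderIntervals K) (N : ℕ) (x : ℕ →₀ ℝ) :
    (truncation hb hK N).completion (toNormingSpace K x) =
      toNormingSpace K (x.filter (· < N)) :=
  ContinuousLinearMap.completion_apply_coe _ _

/-- `supp w_0 < supp w_1 < …`. -/
def IsBlockSequence (w : ℕ → ℕ →₀ ℝ) : Prop :=
  ∀ k l, k < l → ∀ a ∈ (w k).support, ∀ b ∈ (w l).support, a < b

/-- Truncating just before the support of `w_n` keeps the earlier blocks and kills the others, and
truncations are contractive because `K` is closed under intervals. -/
theorem IsBlockSequence.isBasicSequence {K : Set (ℕ →₀ ℝ)} (hb : ∀ φ ∈ K, ∀ n, |φ n| ≤ 1)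
    (hK : ClosedUnderIntervals K) {w : ℕ → ℕ →₀ ℝ} (hw : IsBlockSequence w)
    (hne : ∀ k, normingSeminorm K (w k) ≠ 0) : IsBasicSequence fun k => toNormingSpace K (w k) := by
  have hsupp : ∀ k, (w k).support.Nonempty := fun k => by
    rw [Finsupp.support_nonempty_iff]
    rintro h
    exact hne k (by rw [h, map_zero])
  refine isBasicSequence_of_projections (fun k h => hne k ?_)
    (fun n => (truncation hb hK ((w n).support.min' (hsupp n))).completion)
    (fun n x => norm_completion_truncation_le hb hK _ x) fun n k => ?_
  · rw [← norm_toNormingSpace, h, norm_zero]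
  · rw [completion_truncation_toNormingSpace]
    split_ifs with h
    · rw [(Finsupp.filter_eq_self_iff _ _).2]
      intro a ha
      exact hw k n h a (by simpa using ha) _ (Finset.min'_mem _ _)
    · rw [(Finsupp.filter_eq_zero_iff _ _).2, map_zero]
      intro a ha
      by_contra hak
      have hak' : a ∈ (w k).support := by simpa using hak
      rcases (not_lt.1 h).eq_or_lt with rfl | h
      · exact absurd (Finset.min'_le _ _ hak') (not_le.2 ha)
      · exact absurd (hw n k h _ (Finset.min'_mem _ (hsupp n)) a hak') (not_lt.2 ha.le)

/-! ### Passing from bounded sequences in the completion to block sequences -/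

theorem normingSeminorm_filter_lt_le_mul {K : Set (ℕ →₀ ℝ)} (hb : ∀ φ ∈ K, ∀ n, |φ n| ≤ 1)
    {x : ℕ →₀ ℝ} {N : ℕ} {η : ℝ} (hη : ∀ n < N, |x n| ≤ η) :
    normingSeminorm K (x.filter (· < N)) ≤ N * η := by
  have hx : x.filter (· < N) = ∑ n ∈ Finset.range N, Finsupp.single n (x n) := by
    ext m
    simp [Finsupp.filter_apply, Finsupp.finsetSum_apply, Finsupp.single_apply]
  rw [hx]
  calc normingSeminorm K (∑ n ∈ Finset.range N, Finsupp.single n (x n))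
      ≤ ∑ n ∈ Finset.range N, normingSeminorm K (Finsupp.single n (x n)) :=
        Finset.le_sum_of_subadditive _ (map_zero _).le (map_add_le_add _) _ _
    _ ≤ ∑ n ∈ Finset.range N, η := Finset.sum_le_sum fun n hn =>
        (normingSeminorm_single_le hb n _).trans (hη n (Finset.mem_range.1 hn))
    _ = N * η := by simp

/-- Every bounded sequence has, along an ultrafilter, coordinatewise limits. -/
theorem exists_tendsto_of_bounded {ι : Type*} (U : Ultrafilter ι) {t : ι → ℕ → ℝ} {C : ℝ}
    (h : ∀ i n, |t i n| ≤ C) :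
    ∃ L : ℕ → ℝ, ∀ n, Filter.Tendsto (fun i => t i n) U (nhds (L n)) := by
  have : ∀ n, ∃ L, Filter.Tendsto (fun i => t i n) U (nhds L) := fun n => by
    obtain ⟨L, -, hL⟩ := (isCompact_Icc (a := -C) (b := C)).ultrafilter_le_nhds
      (U.map fun i => t i n) (by
        simp only [Filter.le_principal_iff, Ultrafilter.mem_coe, Ultrafilter.mem_map]
        exact Filter.univ_mem' fun i => abs_le.1 (h i n))
    exact ⟨L, hL⟩
  choose L hL using this
  exact ⟨L, hL⟩

theorem hyperfilter_eventually_ge (N : ℕ) : ∀ᶠ i in (Filter.hyperfilter ℕ : Filter ℕ), N ≤ i :=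
  Nat.hyperfilter_le_atTop (Filter.eventually_ge_atTop N)

/-- Approximants in `c₀₀` converge coordinatewise along an ultrafilter, so the difference of two
late ones is small on any given initial segment, which can be cut off. The bound `2 * k + 1 ≤ i k`
keeps the union of both index sets Schreier. -/
theorem exists_blockSequence_near_differences {K : Set (ℕ →₀ ℝ)}
    (hb : ∀ φ ∈ K, ∀ n, |φ n| ≤ 1) (hbasis : ∀ n, Finsupp.single n 1 ∈ K)
    {x : ℕ → NormingSpace K} (hx : ∀ i, ‖x i‖ ≤ 1) {ε : ℝ} (hε : 0 < ε) :
    ∃ (i i' : ℕ → ℕ) (w : ℕ → ℕ →₀ ℝ), IsBlockSequence w ∧ (∀ k, 2 * k + 1 ≤ i k) ∧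
      (∀ k, i k < i' k) ∧ (∀ k l, k < l → i' k < i l) ∧
      ∀ k, ‖toNormingSpace K (w k) - (x (i k) - x (i' k))‖ ≤ ε * (1 / 2) ^ k := by
  have happ : ∀ i, ∃ y, ‖toNormingSpace K y - x i‖ ≤ min 1 (ε * (1 / 2) ^ i / 4) :=
    fun i => exists_toNormingSpace_near K (x i) (by positivity)
  choose y hy using happ
  have hbd : ∀ i n, |y i n| ≤ 2 := fun i n => by
    refine (abs_apply_le_normingSeminorm hb (hbasis n) _).trans ?_
    rw [← norm_toNormingSpace]
    have h1 := (hy i).trans (min_le_left _ _)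
    have h2 := norm_add_le (toNormingSpace K (y i) - x i) (x i)
    rw [sub_add_cancel] at h2
    linarith [hx i]
  obtain ⟨L, hL⟩ := exists_tendsto_of_bounded (Filter.hyperfilter ℕ) hbd
  have hclose : ∀ (M N : ℕ) (η : ℝ), 0 < η → ∃ i ≥ M, ∀ n < N, |y i n - L n| ≤ η := by
    intro M N η hη
    have h1 : ∀ᶠ i in (Filter.hyperfilter ℕ : Filter ℕ), ∀ n ∈ Finset.range N, |y i n - L n| ≤ η := by
      rw [Filter.eventually_all_finset]
      intro n _
      exact ((hL n).eventually (Metric.closedBall_mem_nhds _ hη)).mono fun i hi => hi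
    obtain ⟨i, hi, hi'⟩ := ((hyperfilter_eventually_ge M).and h1).exists
    exact ⟨i, hi, fun n hn => hi' n (Finset.mem_range.2 hn)⟩
  obtain ⟨f, hf, hfr⟩ := exists_seq_of_forall_finset_exists (α := ℕ × ℕ × ℕ × (ℕ →₀ ℝ))
    (fun s => 1 ≤ s.2.1 ∧ s.2.1 < s.2.2.1 ∧
      ‖toNormingSpace K s.2.2.2 - (x s.2.1 - x s.2.2.1)‖ ≤ ε * (1 / 2) ^ s.1)
    (fun s t => s.1 < t.1 ∧ s.2.2.1 < t.2.1 ∧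
      ∀ a ∈ s.2.2.2.support, ∀ b ∈ t.2.2.2.support, a < b) (by
      intro S _
      set e := S.sup (fun s => s.1) + 1 with he
      set M := S.sup (fun s => s.2.2.1) + 1 with hM
      set N := S.sup (fun s => s.2.2.2.support.sup id) + 1 with hN
      -- The error budget `ε (1/2)^e`: a quarter for each of the two approximations, and `N * (2 *
      -- η)`, one half, for the removed head.
      set η := ε * (1 / 2) ^ e / (4 * N) with hη
      have hN0 : (0 : ℝ) < N := by rw [hN]; positivity
      have hη0 : 0 < η := by positivity
      obtain ⟨i, hi, hyi⟩ := hclose (max e M) N η hη0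
      obtain ⟨j, hj, hyj⟩ := hclose (i + 1) N η hη0
      refine ⟨(e, i, j, (y i - y j) - (y i - y j).filter (· < N)), ⟨?_, hj, ?_⟩, fun s hs => ⟨?_, ?_, ?_⟩⟩
      · exact le_trans (by simp [hM]) hi
      · have hpow : ∀ k, e ≤ k → ‖toNormingSpace K (y k) - x k‖ ≤ ε * (1 / 2) ^ e / 4 := by
          intro k hk
          refine (hy k).trans ((min_le_right _ _).trans ?_)
          have := pow_le_pow_of_le_one (by norm_num : (0 : ℝ) ≤ 1 / 2) (by norm_num) hk
          gcongr ε * ?_ / 4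
        have h1 := hpow i ((le_max_left _ _).trans hi)
        have h2 := hpow j ((le_max_left _ _).trans (hi.trans (Nat.le_of_succ_le hj)))
        have h3 : ‖toNormingSpace K ((y i - y j).filter (· < N))‖ ≤ N * (2 * η) := by
          rw [norm_toNormingSpace]
          refine normingSeminorm_filter_lt_le_mul hb fun n hn => ?_
          have h4 := hyi n hn
          have h5 := hyj n hn
          rw [abs_le] at h4 h5 ⊢
          rw [Finsupp.sub_apply]
          constructor <;> linarith
        have h4 : N * (2 * η) = ε * (1 / 2) ^ e / 2 := by rw [hη]; field_simp; ring
        have h5 : toNormingSpace K ((y i - y j) - (y i - y j).filter (· < N)) - (x i - x j) =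
            ((toNormingSpace K (y i) - x i) - (toNormingSpace K (y j) - x j)) -
              toNormingSpace K ((y i - y j).filter (· < N)) := by
          simp only [map_sub]
          abel
        rw [h5]
        refine (norm_sub_le _ _).trans ((add_le_add_left (norm_sub_le _ _) _).trans ?_)
        linarith
      · exact Nat.lt_succ_of_le (Finset.le_sup (f := fun s => s.1) hs)
      · exact (Nat.lt_succ_of_le (Finset.le_sup (f := fun s => s.2.2.1) hs)).trans_le
          ((le_max_right _ _).trans hi)
      · intro a ha b hb
        have h1 : a ≤ S.sup (fun s => s.2.2.2.support.sup id) :=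
          (Finset.le_sup (f := id) ha).trans
            (Finset.le_sup (f := fun s : ℕ × ℕ × ℕ × (ℕ →₀ ℝ) => s.2.2.2.support.sup id) hs)
        by_contra hab
        have hbN : b < N := by lia
        simp [hbN] at hb)
  have hstage : ∀ k, k ≤ (f k).1 := fun k => by
    induction k with
    | zero => exact Nat.zero_le _
    | succ k ih => exact Nat.succ_le_of_lt (ih.trans_lt (hfr k (k + 1) k.lt_succ_self).1)
  refine ⟨fun k => (f k).2.1, fun k => (f k).2.2.1, fun k => (f k).2.2.2,
    fun k l hkl => (hfr k l hkl).2.2, fun k => ?_, fun k => (hf k).2.1,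
    fun k l hkl => (hfr k l hkl).2.1, fun k => (hf k).2.2.trans ?_⟩
  · induction k with
    | zero => exact (hf 0).1
    | succ k ih =>
      have h1 := (hf k).2.1
      have h2 := (hfr k (k + 1) k.lt_succ_self).2.1
      lia
  · have := pow_le_pow_of_le_one (by norm_num : (0 : ℝ) ≤ 1 / 2) (by norm_num) (hstage k)
    gcongr ε * ?_

/-! ### Exclusion of `c₀` and of `ℓ_p` for `p > 1` -/

theorem two_pow_le_nSeq (j : ℕ) : 2 ^ j ≤ nSeq (j + 1) := by
  induction j with
  | zero => norm_num [nSeq]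
  | succ j ih =>
    show 2 ^ (j + 1) ≤ (2 * nSeq (j + 1)) ^ sSeq (j + 1)
    calc 2 ^ (j + 1) = 2 * 2 ^ j := by ring
      _ ≤ 2 * nSeq (j + 1) := by gcongr
      _ ≤ _ := Nat.le_self_pow (by simp [sSeq]) _

/-- Because `2 n_{j+1} ≥ 2^{j+1}` and `2^{s_{j+1}} = m_{j+2}^3`. The unbounded exponent makes `n_j`
outgrow every fixed power of `m_j`. -/
theorem mSeq_pow_le_nSeq (j : ℕ) : mSeq (j + 2) ^ (3 * (j + 1)) ≤ nSeq (j + 2) := by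
  show _ ≤ (2 * nSeq (j + 1)) ^ sSeq (j + 1)
  calc mSeq (j + 2) ^ (3 * (j + 1)) = (2 ^ (j + 1)) ^ sSeq (j + 1) := by
        rw [mSeq, sSeq, ← pow_mul, ← pow_mul]
        congr 1
        ring
    _ ≤ _ := by
        gcongr
        calc 2 ^ (j + 1) = 2 * 2 ^ j := by ring
          _ ≤ 2 * nSeq (j + 1) := by gcongr; exact two_pow_le_nSeq j

theorem lt_mSeq (j : ℕ) : j < mSeq j :=
  (Nat.lt_pow_self (by norm_num : 1 < 5)).trans (Nat.lt_pow_self (by norm_num))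

theorem exists_mul_mSeq_lt_nSeq_rpow {α : ℝ} (hα : 0 < α) (B : ℝ) :
    ∃ j, 1 ≤ j ∧ B * mSeq j < (nSeq j : ℝ) ^ α := by
  obtain ⟨k, hk⟩ := exists_nat_ge (max B (1 / α))
  refine ⟨k + 2, by lia, ?_⟩
  have hm : (k : ℝ) < mSeq (k + 2) := by
    exact_mod_cast (lt_mSeq (k + 2)).trans' (by lia)
  have hm1 : (1 : ℝ) ≤ mSeq (k + 2) := by exact_mod_cast Nat.one_le_two_pow
  have hm0 : (0 : ℝ) < mSeq (k + 2) := by linarith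
  have hexp : (2 : ℝ) ≤ (3 * (k + 1) : ℕ) * α := by
    have h1 : 1 ≤ k * α := by
      have := (le_max_right _ _).trans hk
      rwa [div_le_iff₀ hα] at this
    push_cast
    nlinarith
  calc B * mSeq (k + 2) ≤ k * mSeq (k + 2) := by
        gcongr
        exact (le_max_left _ _).trans hk
    _ < (mSeq (k + 2) : ℝ) * mSeq (k + 2) := by gcongr
    _ = (mSeq (k + 2) : ℝ) ^ (2 : ℝ) := by norm_cast; ring
    _ ≤ (mSeq (k + 2) : ℝ) ^ ((3 * (k + 1) : ℕ) * α) := Real.rpow_le_rpow_of_exponent_le hm1 hexp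
    _ = ((mSeq (k + 2) : ℝ) ^ (3 * (k + 1))) ^ α := by
        rw [Real.rpow_mul hm0.le, Real.rpow_natCast]
    _ ≤ (nSeq (k + 2) : ℝ) ^ α := by
        refine Real.rpow_le_rpow (by positivity) ?_ hα.le
        exact_mod_cast mSeq_pow_le_nSeq k

/-- A functional in `K` that almost norms `x` and is supported in the range of `x`. -/
theorem exists_norming_in_range {K : Set (ℕ →₀ ℝ)} (hb : ∀ φ ∈ K, ∀ n, |φ n| ≤ 1)
    (hs : IsSymmetric K) (hI : ClosedUnderIntervals K) {x : ℕ →₀ ℝ} {c : ℝ} (hc : 0 ≤ c)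
    (hx : c < normingSeminorm K x) :
    ∃ φ ∈ K, c < pairing φ x ∧
      ∀ n ∈ φ.support, (∃ a ∈ x.support, a ≤ n) ∧ ∃ b ∈ x.support, n ≤ b := by
  obtain ⟨φ, hφ, hφx⟩ := exists_lt_abs_pairing hb hc hx
  obtain ⟨ψ, hψ, hψx⟩ : ∃ ψ ∈ K, c < pairing ψ x := by
    rcases abs_cases (pairing φ x) with ⟨h, -⟩ | ⟨h, -⟩
    · exact ⟨φ, hφ, h ▸ hφx⟩
    · exact ⟨-φ, hs φ hφ, by rw [pairing_neg]; exact h ▸ hφx⟩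
  have hne : x.support.Nonempty := by
    rw [Finsupp.support_nonempty_iff]
    rintro rfl
    rw [map_zero] at hψx
    linarith
  refine ⟨_, hI ψ hψ (x.support.min' hne) (x.support.max' hne), ?_, fun n hn => ?_⟩
  · rw [restrictInterval, pairing_filter, (Finsupp.filter_eq_self_iff _ _).2]
    · exact hψx
    · intro n hn
      have hn : n ∈ x.support := by simpa using hn
      exact ⟨Finset.min'_le _ _ hn, Finset.le_max' _ _ hn⟩
  · rw [restrictInterval, Finsupp.support_filter, Finset.mem_filter] at hn
    exact ⟨⟨_, Finset.min'_mem _ _, hn.2.1⟩, _, Finset.max'_mem _ _, hn.2.2⟩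

/-- Norming functionals living on the ranges of the blocks are successive and vanish on the other
blocks, so one operation combines them. -/
theorem le_normingSeminorm_sum_block {K : Set (ℕ →₀ ℝ)} (hb : ∀ φ ∈ K, ∀ n, |φ n| ≤ 1)
    (hs : IsSymmetric K) (hI : ClosedUnderIntervals K) {j : ℕ} (hop : ClosedUnderOperation K j)
    {w : ℕ → ℕ →₀ ℝ} (hw : IsBlockSequence w) {c : ℝ} (hc : 0 ≤ c)
    (hcw : ∀ k, c < normingSeminorm K (w k)) {F : Finset ℕ} (hF : F.card ≤ nSeq j) :
    (mSeq j : ℝ)⁻¹ * (F.card * c) ≤ normingSeminorm K (∑ k ∈ F, w k) := by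
  choose φ hφ hφw hφs using fun k => exists_norming_in_range hb hs hI hc (hcw k)
  have hlt : ∀ k l, k < l → ∀ a ∈ (φ k).support, ∀ b ∈ (φ l).support, a < b := by
    intro k l hkl a ha b hb
    obtain ⟨-, a', ha', haa⟩ := hφs k a ha
    obtain ⟨⟨b', hb', hbb⟩, -⟩ := hφs l b hb
    exact haa.trans_lt ((hw k l hkl a' ha' b' hb').trans_le hbb)
  have hzero : ∀ k l, k ≠ l → pairing (φ k) (w l) = 0 := by
    intro k l hkl
    refine pairing_eq_zero_of_disjoint (Finset.disjoint_left.2 fun n hn hn' => ?_)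
    obtain ⟨⟨a, ha, han⟩, b, hb, hnb⟩ := hφs k n hn
    rcases lt_or_gt_of_ne hkl with h | h
    · exact absurd (hw k l h b hb n hn') (not_lt.2 hnb)
    · exact absurd (hw l k h n hn' a ha) (not_lt.2 han)
  have hmem : (mSeq j : ℝ)⁻¹ • ∑ k ∈ F, φ k ∈ K := by
    refine hop _ ⟨F.card, hF, fun i => φ (F.orderEmbOfFin rfl i), fun i => hφ _,
      fun i k hik => hlt _ _ ((F.orderEmbOfFin rfl).strictMono hik), ?_⟩
    congr 1
    rw [← Finset.sum_coe_sort F]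
    exact ((F.orderIsoOfFin rfl).toEquiv.sum_comp fun k : F => φ k).symm
  refine le_trans ?_ ((le_abs_self _).trans (abs_pairing_le_normingSeminorm hb hmem _))
  rw [pairing_smul, pairing_sum]
  gcongr
  rw [← nsmul_eq_mul]
  refine Finset.card_nsmul_le_sum _ _ _ fun k hk => ?_
  rw [map_sum, Finset.sum_eq_single_of_mem k hk fun l _ hl => hzero k l hl.symm]
  exact (hφw k).le

theorem GeneratesSpreadingModel.estimates {E : Type*} [NormedAddCommGroup E] [NormedSpace ℝ E]
    {p : ENNReal} {x : ℕ → E} (hx : GeneratesSpreadingModel p x) :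
    ∃ C : ℝ, 1 ≤ C ∧ ∀ F ∈ schreier, ∀ a : ℕ → ℝ,
      C⁻¹ * ‖WithLp.toLp p (fun i : F => a i)‖ ≤ ‖∑ i ∈ F, a i • x i‖ ∧
        ‖∑ i ∈ F, a i • x i‖ ≤ C * ‖WithLp.toLp p (fun i : F => a i)‖ := by
  obtain ⟨-, -, C, hC, h⟩ := hx
  refine ⟨C, hC, fun F hF a => ?_⟩
  rw [← Finset.sum_coe_sort F fun i => a i • x i]
  exact h F hF fun i => a i

theorem sum_mul_half_pow_le (F : Finset ℕ) {ε : ℝ} (hε : 0 ≤ ε) :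
    ∑ k ∈ F, ε * (1 / 2) ^ k ≤ 2 * ε := by
  rw [← Finset.mul_sum, mul_comm 2]
  gcongr
  exact (summable_geometric_two.sum_le_tsum F fun _ _ => by positivity).trans_eq tsum_geometric_two

/-- The sum of `n = n_j` near-differences has norm at least `n / (2 C m_j)` by gluing and at most `3
C n^θ` by the upper estimate, where `θ = 1/p` (and `θ = 0` for `p = ∞`). -/
theorem not_generatesSpreadingModel_of_one_lt {K : Set (ℕ →₀ ℝ)}
    (hb : ∀ φ ∈ K, ∀ n, |φ n| ≤ 1) (hbasis : ∀ n, Finsupp.single n 1 ∈ K) (hs : IsSymmetric K)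
    (hI : ClosedUnderIntervals K) (hop : ∀ j, 1 ≤ j → ClosedUnderOperation K j) {p : ENNReal}
    (hp : 1 < p) (x : ℕ → NormingSpace K) : ¬ GeneratesSpreadingModel p x := by
  intro hx
  have : Fact (1 ≤ p) := ⟨hp.le⟩
  obtain ⟨C, hC, hest⟩ := hx.estimates
  have hC0 : 0 < C := by linarith
  obtain ⟨i, i', w, hw, hi, hii, hil, hnear⟩ :=
    exists_blockSequence_near_differences hb hbasis (fun i => (hx.1 i).le)
      (ε := C⁻¹ / 4) (by positivity)
  have himono : StrictMono i := fun k l hkl => (hii k).trans (hil k l hkl)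
  have himono' : StrictMono i' := fun k l hkl => (hil k l hkl).trans (hii l)
  have hlow : ∀ k, C⁻¹ / 2 < normingSeminorm K (w k) := by
    intro k
    have hF : ({i k, i' k} : Finset ℕ) ∈ schreier := by
      intro a ha
      rw [Finset.card_pair (hii k).ne]
      have := hi k
      have := hii k
      simp only [Finset.mem_insert, Finset.mem_singleton] at ha
      lia
    have h1 := (hest _ hF fun n => if n = i k then 1 else -1).1
    rw [Finset.sum_pair (hii k).ne, if_pos rfl, if_neg (hii k).ne', one_smul, neg_one_smul,
      ← sub_eq_add_neg] at h1
    -- One coordinate bounds the norm from below for every `p`, including `∞`.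
    have h2 := PiLp.norm_apply_le (p := p) (WithLp.toLp p
      (fun n : ({i k, i' k} : Finset ℕ) => if (n : ℕ) = i k then (1 : ℝ) else -1))
      ⟨i k, by simp⟩
    simp only [if_true, norm_one] at h2
    have h3 : C⁻¹ ≤ ‖x (i k) - x (i' k)‖ :=
      (le_mul_of_one_le_right (by positivity) h2).trans h1
    have h4 : C⁻¹ / 4 * (1 / 2) ^ k ≤ C⁻¹ / 4 :=
      mul_le_of_le_one_right (by positivity) (pow_le_one₀ (by norm_num) (by norm_num))
    have h5 := norm_sub_norm_le (x (i k) - x (i' k)) (toNormingSpace K (w k))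
    rw [norm_sub_rev (x (i k) - x (i' k)), norm_toNormingSpace] at h5
    have h6 := hnear k
    have : 0 < C⁻¹ := by positivity
    linarith
  set θ := (1 / p).toReal with hθ
  have hθ1 : θ < 1 := by
    have : 1 / p < 1 := by rw [one_div]; exact ENNReal.inv_lt_one.2 hp
    exact (ENNReal.toReal_lt_toReal this.ne_top ENNReal.one_ne_top).2 this
  have hθ0 : 0 ≤ θ := ENNReal.toReal_nonneg
  obtain ⟨j, hj, hbig⟩ := exists_mul_mSeq_lt_nSeq_rpow (sub_pos.2 hθ1) (6 * C ^ 2)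
  set n := nSeq j with hn
  have hn0 : 1 ≤ n := by
    obtain ⟨l, rfl⟩ := Nat.exists_eq_add_of_le' hj
    exact Nat.one_le_two_pow.trans (two_pow_le_nSeq l)
  have hn0' : (1 : ℝ) ≤ n := by exact_mod_cast hn0
  -- Starting at `n` makes the images of `F` under increasing maps Schreier sets.
  set F := Finset.Ico n (2 * n) with hF
  have hcard : F.card = n := by simp [hF]; lia
  have hup : ∀ f : ℕ → ℕ, StrictMono f → ‖∑ k ∈ F, x (f k)‖ ≤ C * (n : ℝ) ^ θ := by
    intro f hf
    have hS : F.map ⟨f, hf.injective⟩ ∈ schreier := by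
      intro a ha
      obtain ⟨k, hk, rfl⟩ := Finset.mem_map.1 ha
      have h1 := (Finset.mem_Ico.1 hk).1
      have h2 : k ≤ f k := hf.le_apply
      rw [Finset.card_map, hcard]
      show n ≤ f k + 1
      lia
    have h := (hest _ hS fun _ => 1).2
    have : Nonempty (F.map ⟨f, hf.injective⟩) := by
      refine Finset.Nonempty.to_subtype (Finset.card_pos.1 ?_)
      rw [Finset.card_map, hcard]
      lia
    have hnorm := PiLp.norm_toLp_const' (p := p) (ι := F.map ⟨f, hf.injective⟩) (1 : ℝ)
    rw [Fintype.card_coe, Finset.card_map, hcard, norm_one, mul_one] at hnorm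
    simp only [one_smul, Finset.sum_map, Function.Embedding.coeFn_mk] at h
    exact h.trans_eq (congrArg (C * ·) hnorm)
  have hsum : normingSeminorm K (∑ k ∈ F, w k) ≤ 2 * (C * (n : ℝ) ^ θ) + C⁻¹ / 2 := by
    have h1 : ‖∑ k ∈ F, (toNormingSpace K (w k) - (x (i k) - x (i' k)))‖ ≤ C⁻¹ / 2 := by
      refine (norm_sum_le_of_le _ fun k _ => hnear k).trans
        ((sum_mul_half_pow_le F (by positivity)).trans_eq (by ring))
    have h2 := norm_sub_le (∑ k ∈ F, x (i k)) (∑ k ∈ F, x (i' k))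
    have h3 := hup i himono
    have h4 := hup i' himono'
    rw [← norm_toNormingSpace, map_sum]
    have h5 : ∑ k ∈ F, toNormingSpace K (w k) =
        ∑ k ∈ F, (toNormingSpace K (w k) - (x (i k) - x (i' k))) +
          (∑ k ∈ F, x (i k) - ∑ k ∈ F, x (i' k)) := by
      simp only [Finset.sum_sub_distrib]
      abel
    rw [h5]
    refine (norm_add_le _ _).trans ?_
    linarith
  have hlower := le_normingSeminorm_sum_block hb hs hI (hop j hj) hw (by positivity) hlow
    (F := F) (by rw [hcard])
  rw [hcard] at hlower
  have hm0 : (0 : ℝ) < mSeq j := by simp [mSeq]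
  have hθn : (1 : ℝ) ≤ (n : ℝ) ^ θ := Real.one_le_rpow hn0' hθ0
  have hCinv : C⁻¹ ≤ C := (inv_le_one_of_one_le₀ hC).trans hC
  have h6 : (mSeq j : ℝ)⁻¹ * (n * (C⁻¹ / 2)) ≤ 3 * (C * (n : ℝ) ^ θ) := by
    have : C⁻¹ / 2 ≤ C * (n : ℝ) ^ θ := by
      have := le_mul_of_one_le_right hC0.le hθn
      have : 0 < C⁻¹ := by positivity
      linarith
    linarith
  have h7 : (n : ℝ) ≤ 6 * C ^ 2 * mSeq j * (n : ℝ) ^ θ := by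
    have h8 : (n : ℝ) = (mSeq j : ℝ)⁻¹ * (n * (C⁻¹ / 2)) * (2 * C * mSeq j) := by
      field_simp
    rw [h8]
    calc _ ≤ 3 * (C * (n : ℝ) ^ θ) * (2 * C * mSeq j) := by gcongr
      _ = _ := by rw [← h8]; ring
  have h9 : (n : ℝ) = (n : ℝ) ^ (1 - θ) * (n : ℝ) ^ θ := by
    rw [← Real.rpow_add (by linarith), sub_add_cancel, Real.rpow_one]
  have h10 : 6 * C ^ 2 * mSeq j * (n : ℝ) ^ θ < (n : ℝ) ^ (1 - θ) * (n : ℝ) ^ θ := by gcongr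
  linarith

/-! ### Lower `ℓ_1` estimates on Schreier sets -/

/-- `c ∑ |a_k| ≤ ‖∑_{k ∈ F} a_k w_k‖_K` for all `F ∈ 𝒮_1`. -/
def LowerEllOne (K : Set (ℕ →₀ ℝ)) (c : ℝ) (w : ℕ → ℕ →₀ ℝ) : Prop :=
  ∀ F ∈ schreier, ∀ a : ℕ → ℝ, c * ∑ k ∈ F, |a k| ≤ normingSeminorm K (∑ k ∈ F, a k • w k)

theorem exists_block_of_support_sum {F : Finset ℕ} {a : ℕ → ℝ} {w : ℕ → ℕ →₀ ℝ} {n : ℕ}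
    (hn : n ∈ (∑ k ∈ F, a k • w k).support) : ∃ k ∈ F, n ∈ (w k).support := by
  by_contra! h
  rw [Finsupp.mem_support_iff, Finsupp.finsetSum_apply] at hn
  refine hn (Finset.sum_eq_zero fun k hk => ?_)
  rw [Finsupp.smul_apply, Finsupp.notMem_support_iff.1 (h k hk), smul_zero]

/-- Blocks of bounded length of a sequence with a lower `ℓ_1` estimate on Schreier sets. -/
theorem LowerEllOne.exists_blocks {K : Set (ℕ →₀ ℝ)} {c : ℝ} {w : ℕ → ℕ →₀ ℝ}
    (hl : LowerEllOne K c w) (hw : IsBlockSequence w) {n : ℕ} {Q : (ℕ →₀ ℝ) → Prop}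
    (h : ∀ N : ℕ, ∃ (F : Finset ℕ) (a : ℕ → ℝ), F.card ≤ n ∧ (∀ k ∈ F, N ≤ k) ∧
      ∑ k ∈ F, |a k| = 1 ∧ Q (∑ k ∈ F, a k • w k)) :
    ∃ v, IsBlockSequence v ∧ LowerEllOne K c v ∧ ∀ k, Q (v k) := by
  obtain ⟨f, hf, hfr⟩ := exists_seq_of_forall_finset_exists (α := ℕ × Finset ℕ × (ℕ → ℝ))
    (fun s => n ≤ s.1 ∧ s.2.1.card ≤ n ∧ (∀ k ∈ s.2.1, s.1 ≤ k) ∧ ∑ k ∈ s.2.1, |s.2.2 k| = 1 ∧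
      Q (∑ k ∈ s.2.1, s.2.2 k • w k))
    (fun s t => s.1 + n ≤ t.1 ∧ ∀ k ∈ s.2.1, ∀ l ∈ t.2.1, k < l) (by
      intro S _
      set M := S.sup (fun s => s.1 + s.2.1.sup id) + n + 1 with hM
      obtain ⟨F, a, hF, hFM, ha, hQ⟩ := h M
      have hS : ∀ s ∈ S, s.1 + s.2.1.sup id ≤ S.sup (fun s => s.1 + s.2.1.sup id) := fun s hs =>
        Finset.le_sup (f := fun s : ℕ × Finset ℕ × (ℕ → ℝ) => s.1 + s.2.1.sup id) hs
      refine ⟨(M, F, a), ⟨by simp only; lia, hF, hFM, ha, hQ⟩, fun s hs => ⟨?_, fun k hk l hl => ?_⟩⟩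
      · have := hS s hs
        simp only
        lia
      · have h1 := hS s hs
        have h2 : k ≤ s.2.1.sup id := Finset.le_sup (f := id) hk
        have h3 := hFM l hl
        lia)
  -- At most `i + 1` blocks beginning with the `i`-th use at most `n (i + 1)` indices, all beyond
  -- this marker, so Schreier sets of blocks unfold to Schreier sets.
  have hM : ∀ i, n * (i + 1) ≤ (f i).1 := fun i => by
    induction i with
    | zero => simpa using (hf 0).1
    | succ i ih =>
      have := (hfr i (i + 1) i.lt_succ_self).1
      calc n * (i + 1 + 1) = n * (i + 1) + n := by ring
        _ ≤ _ := by lia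
  refine ⟨fun i => ∑ k ∈ (f i).2.1, (f i).2.2 k • w k, ?_, ?_, fun i => (hf i).2.2.2.2⟩
  · intro i j hij a ha b hb
    obtain ⟨k, hk, hak⟩ := exists_block_of_support_sum ha
    obtain ⟨l, hl, hbl⟩ := exists_block_of_support_sum hb
    exact hw k l ((hfr i j hij).2 k hk l hl) a hak b hbl
  · intro S hS b
    have hdisj : (S : Set ℕ).PairwiseDisjoint fun i => (f i).2.1 := by
      intro i _ j _ hij
      refine Finset.disjoint_left.2 fun k hk hk' => ?_
      rcases lt_or_gt_of_ne hij with h | h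
      · exact lt_irrefl k ((hfr i j h).2 k hk k hk')
      · exact lt_irrefl k ((hfr j i h).2 k hk' k hk)
    set e : ℕ → ℝ := fun k => ∑ i ∈ S, if k ∈ (f i).2.1 then b i * (f i).2.2 k else 0 with he
    have hek : ∀ i ∈ S, ∀ k ∈ (f i).2.1, e k = b i * (f i).2.2 k := by
      intro i hi k hk
      rw [he]
      simp only
      rw [Finset.sum_eq_single_of_mem i hi, if_pos hk]
      intro j hj hji
      exact if_neg fun hk' => Finset.disjoint_left.1 (hdisj hj hi hji) hk' hk
    have hU : S.biUnion (fun i => (f i).2.1) ∈ schreier := by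
      intro k hk
      obtain ⟨i, hi, hki⟩ := Finset.mem_biUnion.1 hk
      have h1 : (S.biUnion fun i => (f i).2.1).card ≤ S.card * n :=
        Finset.card_biUnion_le_card_mul _ _ _ fun i _ => (hf i).2.1
      have h2 : S.card * n ≤ (i + 1) * n := Nat.mul_le_mul_right _ (hS i hi)
      have h3 := (hf i).2.2.1 k hki
      have h4 := hM i
      rw [mul_comm] at h4
      lia
    have key := hl _ hU e
    rw [Finset.sum_biUnion hdisj, Finset.sum_biUnion hdisj] at key
    have h1 : ∑ i ∈ S, ∑ k ∈ (f i).2.1, |e k| = ∑ i ∈ S, |b i| := by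
      refine Finset.sum_congr rfl fun i hi => ?_
      rw [Finset.sum_congr rfl fun k hk => by rw [hek i hi k hk, abs_mul], ← Finset.mul_sum,
        (hf i).2.2.2.1, mul_one]
    have h2 : ∑ i ∈ S, ∑ k ∈ (f i).2.1, e k • w k =
        ∑ i ∈ S, b i • ∑ k ∈ (f i).2.1, (f i).2.2 k • w k := by
      refine Finset.sum_congr rfl fun i hi => ?_
      rw [Finset.smul_sum]
      exact Finset.sum_congr rfl fun k hk => by rw [hek i hi k hk, mul_smul]
    rwa [h1, h2] at key

/-- The upper `ℓ_1` estimate is the triangle inequality, and normalizing changes the lower constant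
from `ε` to `ε / B`. -/
theorem generatesSpreadingModel_one_of_lowerEllOne {K : Set (ℕ →₀ ℝ)}
    (hb : ∀ φ ∈ K, ∀ n, |φ n| ≤ 1) (hI : ClosedUnderIntervals K) {w : ℕ → ℕ →₀ ℝ}
    (hw : IsBlockSequence w) {B ε : ℝ} (hε : 0 < ε) (hB : ∀ k, normingSeminorm K (w k) ≤ B)
    (hl : LowerEllOne K ε w) :
    GeneratesSpreadingModel 1 fun k => toNormingSpace K ((normingSeminorm K (w k))⁻¹ • w k) := by
  have hpos : ∀ k, ε ≤ normingSeminorm K (w k) := fun k => by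
    simpa using hl {k} (by intro i hi; simp) fun _ => 1
  have hpos' : ∀ k, 0 < normingSeminorm K (w k) := fun k => hε.trans_le (hpos k)
  have hnorm : ∀ k, normingSeminorm K ((normingSeminorm K (w k))⁻¹ • w k) = 1 := fun k => by
    rw [map_smul_eq_mul, norm_inv, Real.norm_of_nonneg (apply_nonneg _ _),
      inv_mul_cancel₀ (hpos' k).ne']
  have hblock : IsBlockSequence fun k => (normingSeminorm K (w k))⁻¹ • w k :=
    fun k l hkl a ha b hb => hw k l hkl a (Finsupp.support_smul ha) b (Finsupp.support_smul hb)
  have hB0 : 0 < B := (hpos' 0).trans_le (hB 0)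
  refine ⟨fun k => by rw [norm_toNormingSpace, hnorm],
    hblock.isBasicSequence hb hI fun k => by rw [hnorm]; exact one_ne_zero,
    max 1 (B / ε), le_max_left _ _, fun F hF a => ?_⟩
  rw [PiLp.norm_eq_of_L1]
  set a' : ℕ → ℝ := fun k => if h : k ∈ F then a ⟨k, h⟩ else 0 with ha'
  have haa : ∀ k : F, a k = a' k := fun k => by simp [ha']
  simp only [haa, Real.norm_eq_abs]
  rw [Finset.sum_coe_sort F fun k => |a' k|,
    Finset.sum_coe_sort F fun k => a' k • toNormingSpace K ((normingSeminorm K (w k))⁻¹ • w k)]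
  have hsum0 : 0 ≤ ∑ k ∈ F, |a' k| := Finset.sum_nonneg fun _ _ => abs_nonneg _
  constructor
  · have key := hl F hF fun k => a' k * (normingSeminorm K (w k))⁻¹
    simp only [mul_smul] at key
    have h1 : ∑ k ∈ F, a' k • toNormingSpace K ((normingSeminorm K (w k))⁻¹ • w k) =
        toNormingSpace K (∑ k ∈ F, a' k • (normingSeminorm K (w k))⁻¹ • w k) := by
      simp only [map_sum, map_smul]
    rw [h1, norm_toNormingSpace]
    refine le_trans ?_ key
    calc (max 1 (B / ε))⁻¹ * ∑ k ∈ F, |a' k| ≤ (B / ε)⁻¹ * ∑ k ∈ F, |a' k| := by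
          gcongr
          exact le_max_right _ _
      _ = ε * ∑ k ∈ F, |a' k| * B⁻¹ := by rw [inv_div, ← Finset.sum_mul]; ring
      _ ≤ ε * ∑ k ∈ F, |a' k * (normingSeminorm K (w k))⁻¹| := by
          gcongr with k
          rw [abs_mul, abs_of_pos (inv_pos.2 (hpos' k))]
          gcongr
          · exact hpos' k
          · exact hB k
  · calc ‖∑ k ∈ F, a' k • toNormingSpace K ((normingSeminorm K (w k))⁻¹ • w k)‖
        ≤ ∑ k ∈ F, |a' k| := norm_sum_le_of_le _ fun k _ => by
          rw [norm_smul, norm_toNormingSpace, hnorm, mul_one, Real.norm_eq_abs]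
      _ ≤ max 1 (B / ε) * ∑ k ∈ F, |a' k| := le_mul_of_one_le_left hsum0 (le_max_left _ _)

/-- Otherwise, for each length `m`, all normalized combinations of at most `m` terms beyond some `N
m` have norm above `ε`. A diagonal subsequence then has a lower `ℓ_1` estimate on Schreier sets and
yields an `ℓ_1` spreading model. -/
theorem exists_small_combination {K : Set (ℕ →₀ ℝ)} (hb : ∀ φ ∈ K, ∀ n, |φ n| ≤ 1)
    (hI : ClosedUnderIntervals K) (hX : ¬ AdmitsEllSpreadingModel (NormingSpace K) 1)
    {w : ℕ → ℕ →₀ ℝ} (hw : IsBlockSequence w) {B ε : ℝ} (hε : 0 < ε)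
    (hB : ∀ k, normingSeminorm K (w k) ≤ B) :
    ∃ n : ℕ, ∀ N : ℕ, ∃ (F : Finset ℕ) (a : ℕ → ℝ), F.card ≤ n ∧ (∀ k ∈ F, N ≤ k) ∧
      ∑ k ∈ F, |a k| = 1 ∧ normingSeminorm K (∑ k ∈ F, a k • w k) ≤ ε := by
  by_contra! hcon
  choose N hN using hcon
  -- A Schreier set containing `k` has at most `k + 1` elements, so `κ k` must dominate `N m` for `m
  -- ≤ k + 1`.
  set κ : ℕ → ℕ := fun k => k + ∑ m ∈ Finset.range (k + 2), N m with hκ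
  have hmono : StrictMono κ := by
    refine strictMono_nat_of_lt_succ fun k => ?_
    simp only [hκ, Finset.sum_range_succ _ (k + 2)]
    lia
  have hNκ : ∀ m k, m ≤ k + 1 → N m ≤ κ k := fun m k hmk =>
    (Finset.single_le_sum (f := N) (fun _ _ => Nat.zero_le _)
      (Finset.mem_range.2 (Nat.lt_succ_of_le hmk))).trans (Nat.le_add_left _ _)
  refine hX ⟨_, generatesSpreadingModel_one_of_lowerEllOne hb hI (w := fun k => w (κ k))
    (fun k l hkl => hw _ _ (hmono hkl)) hε (fun k => hB _) fun F hF a => ?_⟩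
  set s := ∑ k ∈ F, |a k| with hs
  have hs0 : 0 ≤ s := Finset.sum_nonneg fun k _ => abs_nonneg (a k)
  rcases hs0.eq_or_lt with h0 | h0
  · rw [← h0, mul_zero]
    exact apply_nonneg _ _
  set a' : ℕ → ℝ := Function.extend κ (fun k => s⁻¹ * a k) 0 with ha'
  have hak : ∀ k, a' (κ k) = s⁻¹ * a k := fun k => hmono.injective.extend_apply _ _ _
  have key := hN F.card (F.map ⟨κ, hmono.injective⟩) a' (by rw [Finset.card_map])
    (by
      intro k hk
      obtain ⟨l, hl, rfl⟩ := Finset.mem_map.1 hk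
      exact hNκ _ _ (hF l hl))
    (by
      simp only [Finset.sum_map, Function.Embedding.coeFn_mk, hak, abs_mul, ← Finset.mul_sum]
      rw [abs_of_pos (inv_pos.2 h0), inv_mul_cancel₀ h0.ne'])
  simp only [Finset.sum_map, Function.Embedding.coeFn_mk, hak, mul_smul, ← Finset.smul_sum] at key
  rw [map_smul_eq_mul, Real.norm_of_nonneg (inv_nonneg.2 h0.le), inv_mul_eq_div,
    lt_div_iff₀ h0] at key
  exact key.le

/-! ### The action of weighted functionals -/

theorem restrictInterval_sum_smul {ι : Type*} (a b : ℕ) (s : Finset ι) (c : ι → ℝ)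
    (f : ι → ℕ →₀ ℝ) :
    restrictInterval a b (∑ i ∈ s, c i • f i) = ∑ i ∈ s, c i • restrictInterval a b (f i) := by
  ext n
  simp only [restrictInterval, Finsupp.filter_apply, Finsupp.finsetSum_apply, Finsupp.smul_apply]
  split_ifs <;> simp

theorem support_restrictInterval_subset (a b : ℕ) (f : ℕ →₀ ℝ) :
    (restrictInterval a b f).support ⊆ f.support := by
  rw [restrictInterval, Finsupp.support_filter]
  exact Finset.filter_subset _ _

theorem restrictInterval_restrictInterval (a b a' b' : ℕ) (f : ℕ →₀ ℝ) :
    restrictInterval a' b' (restrictInterval a b f) =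
      restrictInterval (max a a') (min b b') f := by
  ext n
  simp only [restrictInterval, Finsupp.filter_apply]
  split_ifs <;> first | rfl | (exfalso; lia)

theorem IsOperationResult.restrictInterval {K : Set (ℕ →₀ ℝ)} (hI : ClosedUnderIntervals K) {j : ℕ}
    {f : ℕ →₀ ℝ} (hf : IsOperationResult K j f) (a b : ℕ) :
    IsOperationResult K j (restrictInterval a b f) := by
  obtain ⟨d, hd, g, hg, hs, rfl⟩ := hf
  refine ⟨d, hd, fun i => SpreadingModels.restrictInterval a b (g i), fun i => hI _ (hg i) a b,
    fun i k hik x hx y hy => hs i k hik x ?_ y ?_, ?_⟩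
  · exact support_restrictInterval_subset a b _ hx
  · exact support_restrictInterval_subset a b _ hy
  · simpa [Finset.smul_sum] using
      restrictInterval_sum_smul a b Finset.univ (fun _ => (mSeq j : ℝ)⁻¹) g

theorem IsOperationResult.mono {K L : Set (ℕ →₀ ℝ)} (h : K ⊆ L) {j : ℕ} {f : ℕ →₀ ℝ}
    (hf : IsOperationResult K j f) : IsOperationResult L j f := by
  obtain ⟨d, hd, g, hg, hs, rfl⟩ := hf
  exact ⟨d, hd, g, fun i => h (hg i), hs, rfl⟩

/-- In the smallest fully closed set, it suffices to bound the action of the ground set and of the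
`ℓ_2`-combinations of weighted functionals. -/
theorem normingSeminorm_le_of_l2Combinations {G K : Set (ℕ →₀ ℝ)} (hK : IsFullyClosed G K)
    (hGI : ClosedUnderIntervals G) (hmin : K ⊆ fullClosure G) (hb : ∀ φ ∈ K, ∀ n, |φ n| ≤ 1)
    {x : ℕ →₀ ℝ} {B : ℝ} (hG : normingSeminorm G x ≤ B)
    (h : ∀ (d : ℕ) (f : Fin d → ℕ →₀ ℝ) (j : Fin d → ℕ) (c : Fin d → ℚ),
      (∀ i, 1 ≤ j i) → Function.Injective j → (∀ i, f i ∈ K ∧ IsOperationResult K (j i) (f i)) →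
      ∑ i, c i ^ 2 ≤ 1 → |pairing (∑ i, (c i : ℝ) • f i) x| ≤ B) :
    normingSeminorm K x ≤ B := by
  have hB : 0 ≤ B := (apply_nonneg _ _).trans hG
  -- All interval restrictions are included in the bound so that the set is itself closed under
  -- intervals. Minimality then applies to it.
  have hcl : IsFullyClosed G {f | f ∈ K ∧ ∀ a b, |pairing (restrictInterval a b f) x| ≤ B} := by
    refine ⟨fun f hf => ⟨hK.symm f hf.1, fun a b => ?_⟩, fun f hf a b =>
      ⟨hK.interval f hf.1 a b, fun a' b' => ?_⟩, fun f hf => ⟨hK.subset hf, fun a b => ?_⟩,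
      fun j hj f hf => ?_, fun d f j c hj hinj hf hc => ?_, fun d f r hf hr hsum => ?_⟩
    · have := hf.2 a b
      rwa [restrictInterval, Finsupp.filter_neg, pairing_neg, abs_neg]
    · rw [restrictInterval_restrictInterval]
      exact hf.2 _ _
    · exact (abs_pairing_le_normingSeminorm (fun φ hφ => hb φ (hK.subset hφ))
        (hGI f hf a b) x).trans hG
    · have hf' := hf.mono (fun _ h => h.1 : _ ⊆ K)
      refine ⟨hK.operation j hj f hf', fun a b => ?_⟩
      have hr := hf'.restrictInterval hK.interval a b
      simpa using h 1 (fun _ => restrictInterval a b f) (fun _ => j) (fun _ => 1) (fun _ => hj)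
        (fun _ _ _ => Subsingleton.elim _ _) (fun _ => ⟨hK.operation j hj _ hr, hr⟩) (by simp)
    · have hf' : ∀ i, IsOperationResult K (j i) (f i) :=
        fun i => (hf i).2.mono (fun _ h => h.1 : _ ⊆ K)
      refine ⟨hK.l2 d f j c hj hinj (fun i => ⟨(hf i).1.1, hf' i⟩) hc, fun a b => ?_⟩
      rw [restrictInterval_sum_smul]
      exact h d _ j c hj hinj (fun i => ⟨hK.interval _ (hf i).1.1 a b,
        (hf' i).restrictInterval hK.interval a b⟩) hc
    · refine ⟨hK.convex d f r (fun i => (hf i).1) hr hsum, fun a b => ?_⟩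
      rw [restrictInterval_sum_smul, pairing_sum_smul]
      calc |∑ i, (r i : ℝ) * pairing (restrictInterval a b (f i)) x|
          ≤ ∑ i, |(r i : ℝ) * pairing (restrictInterval a b (f i)) x| :=
            Finset.abs_sum_le_sum_abs _ _
        _ ≤ ∑ i, (r i : ℝ) * B := by
            refine Finset.sum_le_sum fun i _ => ?_
            have hri : (0 : ℝ) ≤ r i := by exact_mod_cast hr i
            rw [abs_mul, abs_of_nonneg hri]
            exact mul_le_mul_of_nonneg_left ((hf i).2 a b) hri
        _ = B := by
            rw [← Finset.sum_mul]
            have : (∑ i, (r i : ℝ)) = 1 := by exact_mod_cast hsum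
            rw [this, one_mul]
  refine normingSeminorm_le hb hB fun φ hφ => ?_
  have hφ' := (hmin hφ _ hcl).2 0 (x.support.sup id)
  rwa [restrictInterval, pairing_filter, (Finsupp.filter_eq_self_iff _ _).2] at hφ'
  intro n hn
  exact ⟨Nat.zero_le _, Finset.le_sup (f := id) (by simpa using hn)⟩

/-- At most `n_j` members of a block sequence are split by a result of an operation of index `j`. -/
theorem IsOperationResult.sum_abs_pairing_le {K : Set (ℕ →₀ ℝ)} (hb : ∀ φ ∈ K, ∀ n, |φ n| ≤ 1)
    {j : ℕ} {f : ℕ →₀ ℝ} (hf : IsOperationResult K j f) (hfK : f ∈ K) {w : ℕ → ℕ →₀ ℝ}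
    (hw : IsBlockSequence w) {C : ℝ} (hC : ∀ k, normingSeminorm K (w k) ≤ C) (F : Finset ℕ) :
    ∑ k ∈ F, |pairing f (w k)| ≤ C * (F.card * (mSeq j : ℝ)⁻¹ + nSeq j) := by
  classical
  have hC0 : 0 ≤ C := (apply_nonneg _ _).trans (hC 0)
  have hall : ∀ k, |pairing f (w k)| ≤ C := fun k =>
    (abs_pairing_le_normingSeminorm hb hfK _).trans (hC k)
  obtain ⟨d, hd, g, hg, hs, rfl⟩ := hf
  set bad : ℕ → Prop := fun k => ∃ i i' : Fin d, i < i' ∧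
    (∃ a ∈ (w k).support, a ∈ (g i).support) ∧ ∃ a ∈ (w k).support, a ∈ (g i').support with hbad
  have hcard : (F.filter bad).card ≤ nSeq j := by
    have hex : ∀ k : ℕ, ∃ i : ℕ, bad k → ∃ h : i < d, ∃ i' : Fin d, ⟨i, h⟩ < i' ∧
        (∃ a ∈ (w k).support, a ∈ (g ⟨i, h⟩).support) ∧ ∃ a ∈ (w k).support, a ∈ (g i').support := by
      intro k
      by_cases h : bad k
      · obtain ⟨i, i', h⟩ := h
        exact ⟨i, fun _ => ⟨i.2, i', h⟩⟩
      · exact ⟨0, fun h' => absurd h' h⟩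
    choose ι hι using hex
    refine le_trans ?_ ((Finset.card_range d).le.trans hd)
    refine Finset.card_le_card_of_injOn ι (fun k hk => ?_) ?_
    · obtain ⟨h, -⟩ := hι k (Finset.mem_filter.1 hk).2
      simpa using h
    -- A split block is charged to an index `i` of a piece it meets while also meeting a later
    -- piece. If `k < l` shared `i`, block `l` would meet `g_i` to the right of where block `k`
    -- meets a later piece.
    · have key : ∀ k l, bad k → bad l → k < l → ι k ≠ ι l := by
        intro k l hk hl hkl heq
        obtain ⟨h, i', hi', -, a, ha, hag⟩ := hι k hk
        obtain ⟨h', -, -, ⟨b, hb, hbg⟩, -⟩ := hι l hl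
        have h1 := hw k l hkl a ha b hb
        have h2 := hs _ i' hi' b (by simpa only [heq] using hbg) a hag
        exact lt_asymm h1 h2
      intro k hk l hl heq
      have hk := (Finset.mem_filter.1 hk).2
      have hl := (Finset.mem_filter.1 hl).2
      rcases lt_trichotomy k l with h | h | h
      · exact absurd heq (key k l hk hl h)
      · exact h
      · exact absurd heq.symm (key l k hl hk h)
  have hm0 : (0 : ℝ) ≤ (mSeq j : ℝ)⁻¹ := by positivity
  have hgood : ∀ k, ¬ bad k → |pairing ((mSeq j : ℝ)⁻¹ • ∑ i, g i) (w k)| ≤ C * (mSeq j : ℝ)⁻¹ := by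
    intro k hk
    rw [pairing_smul, pairing_sum, abs_mul, abs_of_nonneg hm0, mul_comm]
    refine mul_le_mul_of_nonneg_right ?_ hm0
    by_cases hex : ∃ i, ∃ a ∈ (w k).support, a ∈ (g i).support
    · obtain ⟨i, hi⟩ := hex
      rw [Finset.sum_eq_single_of_mem i (Finset.mem_univ _)]
      · exact (abs_pairing_le_normingSeminorm hb (hg i) _).trans (hC k)
      · intro i' _ hii
        refine pairing_eq_zero_of_disjoint (Finset.disjoint_right.2 fun a ha ha' => hk ?_)
        rcases lt_or_gt_of_ne hii with h | h
        · exact ⟨i', i, h, ⟨a, ha, ha'⟩, hi⟩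
        · exact ⟨i, i', h, hi, a, ha, ha'⟩
    · push Not at hex
      rw [Finset.sum_eq_zero fun i _ => pairing_eq_zero_of_disjoint
        (Finset.disjoint_right.2 fun a ha => hex i a ha), abs_zero]
      exact hC0
  calc ∑ k ∈ F, |pairing ((mSeq j : ℝ)⁻¹ • ∑ i, g i) (w k)|
      ≤ ∑ k ∈ F, (C * (mSeq j : ℝ)⁻¹ + if bad k then C else 0) := by
        refine Finset.sum_le_sum fun k _ => ?_
        split_ifs with h
        · exact (hall k).trans (le_add_of_nonneg_left (mul_nonneg hC0 hm0))
        · simpa using hgood k h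
    _ = F.card * (C * (mSeq j : ℝ)⁻¹) + (F.filter bad).card * C := by
        rw [Finset.sum_add_distrib, Finset.sum_const, nsmul_eq_mul, ← Finset.sum_filter,
          Finset.sum_const, nsmul_eq_mul]
    _ ≤ F.card * (C * (mSeq j : ℝ)⁻¹) + nSeq j * C := by gcongr
    _ = _ := by ring

/-- The norm given by the results of operations of index `j`. -/
def weightedNorm (K : Set (ℕ →₀ ℝ)) (j : ℕ) (x : ℕ →₀ ℝ) : ℝ :=
  ⨆ f : {f | f ∈ K ∧ IsOperationResult K j f}, |pairing f x|

theorem weightedNorm_nonneg (K : Set (ℕ →₀ ℝ)) (j : ℕ) (x : ℕ →₀ ℝ) : 0 ≤ weightedNorm K j x :=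
  Real.iSup_nonneg fun _ => abs_nonneg _

theorem abs_pairing_le_weightedNorm {K : Set (ℕ →₀ ℝ)} (hb : ∀ φ ∈ K, ∀ n, |φ n| ≤ 1) {j : ℕ}
    {f : ℕ →₀ ℝ} (hfK : f ∈ K) (hf : IsOperationResult K j f) (x : ℕ →₀ ℝ) :
    |pairing f x| ≤ weightedNorm K j x :=
  le_ciSup (f := fun f : {f | f ∈ K ∧ IsOperationResult K j f} => |pairing f x|)
    ⟨normingSeminorm K x, by
      rintro _ ⟨φ, rfl⟩
      exact abs_pairing_le_normingSeminorm hb φ.2.1 x⟩ ⟨f, hfK, hf⟩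

theorem IsOperationResult.neg {K : Set (ℕ →₀ ℝ)} (hs : IsSymmetric K) {j : ℕ} {f : ℕ →₀ ℝ}
    (hf : IsOperationResult K j f) : IsOperationResult K j (-f) := by
  obtain ⟨d, hd, g, hg, hsuc, rfl⟩ := hf
  refine ⟨d, hd, fun i => -g i, fun i => hs _ (hg i), fun i k hik a ha b hb => ?_, by simp⟩
  rw [Finsupp.support_neg] at ha hb
  exact hsuc i k hik a ha b hb

theorem exists_weightedNorm_sub_le {K : Set (ℕ →₀ ℝ)} (hs : IsSymmetric K) (h0 : 0 ∈ K) (j : ℕ)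
    (x : ℕ →₀ ℝ) {δ : ℝ} (hδ : 0 < δ) :
    ∃ f, f ∈ K ∧ IsOperationResult K j f ∧ weightedNorm K j x - δ ≤ pairing f x := by
  have : Nonempty {f | f ∈ K ∧ IsOperationResult K j f} :=
    ⟨0, h0, 0, Nat.zero_le _, Fin.elim0, fun i => i.elim0, fun i => i.elim0, by simp⟩
  obtain ⟨⟨f, hf, hf'⟩, h⟩ := exists_lt_of_lt_ciSup (sub_lt_self (weightedNorm K j x) hδ)
  simp only at h
  rcases abs_cases (pairing f x) with ⟨h1, -⟩ | ⟨h1, -⟩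
  · exact ⟨f, hf, hf', by rw [← h1]; exact h.le⟩
  · exact ⟨-f, hs f hf, hf'.neg hs, by rw [pairing_neg, ← h1]; exact h.le⟩

theorem sum_mul_weightedNorm_le {K : Set (ℕ →₀ ℝ)} (hb : ∀ φ ∈ K, ∀ n, |φ n| ≤ 1)
    (hs : IsSymmetric K) (hl2 : ClosedUnderL2Combinations K) (x : ℕ →₀ ℝ) {S : Finset ℕ}
    (hS : ∀ j ∈ S, 1 ≤ j) {c : ℕ → ℚ} (hc0 : ∀ j, 0 ≤ c j) (hc : ∑ j ∈ S, c j ^ 2 ≤ 1) :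
    ∑ j ∈ S, (c j : ℝ) * weightedNorm K j x ≤ normingSeminorm K x := by
  have h0 := zero_mem_of_l2 hl2
  have hbound : ∀ δ > 0, ∑ j ∈ S, (c j : ℝ) * (weightedNorm K j x - δ) ≤ normingSeminorm K x := by
    intro δ hδ
    choose f hf hf' hfx using fun j => exists_weightedNorm_sub_le hs h0 j x hδ
    set e := S.orderIsoOfFin rfl
    have hsum : ∀ {M : Type} [AddCommMonoid M] (g : ℕ → M), ∑ i, g (e i) = ∑ j ∈ S, g j := by
      intro M _ g
      rw [← Finset.sum_coe_sort S]
      exact e.toEquiv.sum_comp fun k : S => g k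
    have hmem := hl2 S.card (fun i => f (e i)) (fun i => e i) (fun i => c (e i))
      (fun i => hS _ (e i).2) (fun i k h => e.injective (Subtype.ext h))
      (fun i => ⟨hf _, hf' _⟩) (by rwa [hsum fun j => c j ^ 2])
    rw [hsum fun j => (c j : ℝ) • f j] at hmem
    refine le_trans ?_ ((le_abs_self _).trans (abs_pairing_le_normingSeminorm hb hmem x))
    rw [pairing_sum_smul]
    refine Finset.sum_le_sum fun j _ => mul_le_mul_of_nonneg_left (hfx j) ?_
    exact_mod_cast hc0 j
  have hlim : Filter.Tendsto (fun δ : ℝ => ∑ j ∈ S, (c j : ℝ) * (weightedNorm K j x - δ))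
      (nhdsWithin 0 (Set.Ioi 0)) (nhds (∑ j ∈ S, (c j : ℝ) * (weightedNorm K j x - 0))) :=
    ((by fun_prop : Continuous fun δ : ℝ =>
      ∑ j ∈ S, (c j : ℝ) * (weightedNorm K j x - δ)).tendsto 0).mono_left nhdsWithin_le_nhds
  simpa using le_of_tendsto hlim (Filter.eventually_of_mem self_mem_nhdsWithin hbound)

/-- Duality in `ℓ_2`: the extremal coefficients `a_j / √A` are replaced by nearby rationals. -/
theorem sum_sq_le_of_rat_combinations {S : Finset ℕ} {a : ℕ → ℝ} (ha : ∀ j, 0 ≤ a j) {N : ℝ}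
    (hN : 0 ≤ N) (h : ∀ c : ℕ → ℚ, (∀ j, 0 ≤ c j) → ∑ j ∈ S, c j ^ 2 ≤ 1 →
      ∑ j ∈ S, (c j : ℝ) * a j ≤ N) : ∑ j ∈ S, a j ^ 2 ≤ N ^ 2 := by
  by_contra! hlt
  set A := ∑ j ∈ S, a j ^ 2 with hA
  have hA0 : 0 < A := (sq_nonneg N).trans_lt hlt
  have hsq : √A * √A = A := Real.mul_self_sqrt hA0.le
  have hs0 : 0 < √A := Real.sqrt_pos.2 hA0
  have hNs : N < √A := Real.lt_sqrt_of_sq_lt hlt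
  -- Rounding `√A` up and the `a_j` down keeps the squares summing to at most `1`. The gap `A - N r`
  -- absorbs the loss from rounding the `a_j`.
  obtain ⟨r, hr1, hr2⟩ : ∃ r : ℚ, √A < r ∧ N * r < A := by
    have hdiff : 0 < (A - N * √A) / (N + 1) := by
      apply div_pos _ (by linarith)
      nlinarith
    obtain ⟨r, h1, h2⟩ := exists_rat_btwn (lt_add_of_pos_right (√A) hdiff)
    refine ⟨r, h1, ?_⟩
    have h3 : (r - √A) * (N + 1) < A - N * √A := by
      rw [← lt_div_iff₀ (by linarith)]
      linarith
    nlinarith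
  have hr0 : (0 : ℝ) < r := hs0.trans hr1
  set T := ∑ j ∈ S, a j with hT
  have hT0 : 0 ≤ T := Finset.sum_nonneg fun j _ => ha j
  set η := (A - N * r) / (T + 1) with hη
  have hη0 : 0 < η := div_pos (by linarith) (by linarith)
  have hq : ∀ j, ∃ q : ℚ, 0 ≤ q ∧ (q : ℝ) ≤ a j ∧ a j - η ≤ q := by
    intro j
    obtain ⟨q, h1, h2⟩ := exists_rat_btwn (sub_lt_self (a j) hη0)
    refine ⟨max q 0, le_max_right _ _, ?_, ?_⟩
    · push_cast
      exact max_le h2.le (ha j)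
    · push_cast
      exact h1.le.trans (le_max_left _ _)
  choose q hq0 hqa hqη using hq
  have hrq : (0 : ℚ) < r := by exact_mod_cast hr0
  have key := h (fun j => q j / r) (fun j => div_nonneg (hq0 j) hrq.le) (by
    have h1 : ∑ j ∈ S, (q j : ℝ) ^ 2 ≤ (r : ℝ) ^ 2 := by
      calc ∑ j ∈ S, (q j : ℝ) ^ 2 ≤ A := Finset.sum_le_sum fun j _ =>
            pow_le_pow_left₀ (by exact_mod_cast hq0 j) (hqa j) 2
        _ ≤ (r : ℝ) ^ 2 := by nlinarith
    have h2 : ∑ j ∈ S, q j ^ 2 ≤ r ^ 2 := by exact_mod_cast h1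
    simp only [div_pow]
    rw [← Finset.sum_div]
    exact (div_le_one (by positivity)).2 h2)
  have h1 : ∑ j ∈ S, (q j : ℝ) * a j ≤ N * r := by
    have h2 : ∑ j ∈ S, ((q j / r : ℚ) : ℝ) * a j = (∑ j ∈ S, (q j : ℝ) * a j) / r := by
      rw [Finset.sum_div]
      refine Finset.sum_congr rfl fun j _ => ?_
      push_cast
      ring
    rwa [h2, div_le_iff₀ hr0] at key
  have h2 : A - η * T ≤ ∑ j ∈ S, (q j : ℝ) * a j := by
    rw [hA, hT, Finset.mul_sum, ← Finset.sum_sub_distrib]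
    refine Finset.sum_le_sum fun j _ => ?_
    have := mul_le_mul_of_nonneg_right (hqη j) (ha j)
    nlinarith
  have h3 : η * (T + 1) = A - N * r := div_mul_cancel₀ _ (by linarith)
  nlinarith

/-- This is where closure under `ℓ_2`-combinations enters the `ℓ_1` case: it places the weighted
norms of `x` in a ball of `ℓ_2`. -/
theorem sum_sq_weightedNorm_le {K : Set (ℕ →₀ ℝ)} (hb : ∀ φ ∈ K, ∀ n, |φ n| ≤ 1)
    (hs : IsSymmetric K) (hl2 : ClosedUnderL2Combinations K) (x : ℕ →₀ ℝ) {S : Finset ℕ}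
    (hS : ∀ j ∈ S, 1 ≤ j) : ∑ j ∈ S, weightedNorm K j x ^ 2 ≤ normingSeminorm K x ^ 2 :=
  sum_sq_le_of_rat_combinations (fun j => weightedNorm_nonneg K j x) (apply_nonneg _ _)
    fun _ hc0 hc => sum_mul_weightedNorm_le hb hs hl2 x hS hc0 hc

/-! ### Averages of bounded sequences in `ℓ_2` -/

theorem exists_tail_sum_sq_le {a : ℕ → ℝ} {B : ℝ} (h : ∀ S : Finset ℕ, ∑ j ∈ S, a j ^ 2 ≤ B)
    {δ : ℝ} (hδ : 0 < δ) :
    ∃ J : ℕ, ∀ S : Finset ℕ, (∀ j ∈ S, J ≤ j) → ∑ j ∈ S, a j ^ 2 ≤ δ := by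
  have hsum : Summable fun j => a j ^ 2 := summable_of_sum_le (fun _ => sq_nonneg _) h
  obtain ⟨s, hs⟩ := summable_iff_vanishing_norm.1 hsum δ hδ
  refine ⟨s.sup id + 1, fun S hS => ?_⟩
  refine (le_abs_self _).trans (hs S (Finset.disjoint_left.2 fun j hj hj' => ?_)).le
  have h1 : j ≤ s.sup id := Finset.le_sup (f := id) hj'
  have h2 := hS j hj
  lia

theorem sum_mul_le_of_sum_sq_le {S : Finset ℕ} {a b : ℕ → ℝ} {A B : ℝ} (hA : 0 ≤ A) (hB : 0 ≤ B)
    (ha : ∑ j ∈ S, a j ^ 2 ≤ A ^ 2) (hb : ∑ j ∈ S, b j ^ 2 ≤ B ^ 2) :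
    ∑ j ∈ S, a j * b j ≤ A * B := by
  refine le_of_abs_le (abs_le_of_sq_le_sq ?_ (mul_nonneg hA hB))
  calc (∑ j ∈ S, a j * b j) ^ 2 ≤ (∑ j ∈ S, a j ^ 2) * ∑ j ∈ S, b j ^ 2 :=
        Finset.sum_mul_sq_le_sq_mul_sq _ _ _
    _ ≤ A ^ 2 * B ^ 2 := mul_le_mul ha hb (Finset.sum_nonneg fun _ _ => sq_nonneg _) (sq_nonneg _)
    _ = (A * B) ^ 2 := by ring

/-- Sums of well chosen members of a bounded sequence in `ℓ_2` are small on a tail of the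
coordinates: the tails of far apart members are almost orthogonal. -/
theorem exists_almost_orthogonal {t : ℕ → ℕ → ℝ} {C : ℝ} (hC : 0 < C)
    (ht : ∀ k, ∀ S : Finset ℕ, ∑ j ∈ S, t k j ^ 2 ≤ C ^ 2) {η : ℝ} (hη : 0 < η) :
    ∃ J : ℕ, ∀ n N : ℕ, ∃ F : Finset ℕ, F.card = n ∧ (∀ k ∈ F, N ≤ k) ∧
      ∀ S : Finset ℕ, (∀ j ∈ S, J ≤ j) →
        ∑ j ∈ S, (∑ k ∈ F, t k j) ^ 2 ≤ n * C ^ 2 + (n : ℝ) ^ 2 * η := by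
  classical
  have hbd : ∀ k j, |t k j| ≤ C := fun k j =>
    abs_le_of_sq_le_sq (by simpa using ht k {j}) hC.le
  obtain ⟨L, hL⟩ := exists_tendsto_of_bounded (Filter.hyperfilter ℕ) hbd
  have hLsum : ∀ S : Finset ℕ, Filter.Tendsto (fun k => ∑ j ∈ S, t k j ^ 2)
      (Filter.hyperfilter ℕ : Filter ℕ) (nhds (∑ j ∈ S, L j ^ 2)) := fun S =>
    tendsto_finsetSum _ fun j _ => (hL j).pow 2
  have hLC : ∀ S : Finset ℕ, ∑ j ∈ S, L j ^ 2 ≤ C ^ 2 := fun S =>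
    le_of_tendsto (hLsum S) (Filter.Eventually.of_forall fun k => ht k S)
  set δ := η / (3 * C) with hδ
  have hδ0 : 0 < δ := by positivity
  obtain ⟨J, hJ⟩ := exists_tail_sum_sq_le hLC (pow_pos hδ0 2)
  refine ⟨J, fun n N => ?_⟩
  have hortho : ∀ r, ∀ᶠ k in (Filter.hyperfilter ℕ : Filter ℕ),
      ∀ S : Finset ℕ, (∀ j ∈ S, J ≤ j) → ∑ j ∈ S, t r j * t k j ≤ η := by
    intro r
    -- Beyond `J'` the vector `t r` is small. On `[J, J')` a late `t k` is close to the limit `L`,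
    -- whose tail from `J` is small. The two parts give `2 C δ + C δ = η`.
    obtain ⟨J', hJ'⟩ := exists_tail_sum_sq_le (ht r) (pow_pos hδ0 2)
    have hev : ∀ᶠ k in (Filter.hyperfilter ℕ : Filter ℕ),
        ∑ j ∈ Finset.Ico J J', t k j ^ 2 < (2 * δ) ^ 2 := by
      refine (hLsum _).eventually_lt_const ?_
      refine (hJ _ fun j hj => (Finset.mem_Ico.1 hj).1).trans_lt ?_
      nlinarith [pow_pos hδ0 2]
    filter_upwards [hev] with k hk S hS
    rw [← Finset.sum_filter_add_sum_filter_not S (· < J')]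
    have h1 : ∑ j ∈ S.filter (· < J'), t r j * t k j ≤ C * (2 * δ) := by
      refine sum_mul_le_of_sum_sq_le hC.le (by positivity) (ht r _) (le_trans ?_ hk.le)
      refine Finset.sum_le_sum_of_subset_of_nonneg (fun j hj => ?_) fun _ _ _ => sq_nonneg _
      rw [Finset.mem_filter] at hj
      exact Finset.mem_Ico.2 ⟨hS j hj.1, hj.2⟩
    have h2 : ∑ j ∈ S.filter (¬ · < J'), t r j * t k j ≤ δ * C := by
      refine sum_mul_le_of_sum_sq_le hδ0.le hC.le (hJ' _ fun j hj => ?_) (ht k _)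
      exact not_lt.1 (Finset.mem_filter.1 hj).2
    have h3 : 3 * C * δ = η := by rw [hδ]; field_simp
    linarith
  obtain ⟨f, hf, hfr⟩ := exists_seq_of_forall_finset_exists (fun k : ℕ => N ≤ k)
    (fun r k => r < k ∧ ∀ S : Finset ℕ, (∀ j ∈ S, J ≤ j) → ∑ j ∈ S, t r j * t k j ≤ η) (by
      intro s _
      have h1 : ∀ᶠ k in (Filter.hyperfilter ℕ : Filter ℕ), ∀ r ∈ s, r < k ∧
          ∀ S : Finset ℕ, (∀ j ∈ S, J ≤ j) → ∑ j ∈ S, t r j * t k j ≤ η := by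
        rw [Filter.eventually_all_finset]
        exact fun r _ => (hyperfilter_eventually_ge (r + 1)).and (hortho r)
      exact ((hyperfilter_eventually_ge N).and h1).exists)
  have hmono : StrictMono f := fun k l hkl => (hfr k l hkl).1
  refine ⟨(Finset.range n).map ⟨f, hmono.injective⟩, by simp, fun k hk => ?_, fun S hS => ?_⟩
  · obtain ⟨l, -, rfl⟩ := Finset.mem_map.1 hk
    exact hf l
  simp only [Finset.sum_map, Function.Embedding.coeFn_mk]
  have hcross : ∀ k l, ∑ j ∈ S, t (f k) j * t (f l) j ≤ η + if k = l then C ^ 2 else 0 := by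
    intro k l
    rcases lt_trichotomy k l with h | rfl | h
    · rw [if_neg h.ne, add_zero]
      exact (hfr k l h).2 S hS
    · rw [if_pos rfl]
      have := ht (f k) S
      simp only [pow_two] at this ⊢
      linarith
    · rw [if_neg h.ne', add_zero]
      refine le_trans (le_of_eq ?_) ((hfr l k h).2 S hS)
      exact Finset.sum_congr rfl fun j _ => mul_comm _ _
  calc ∑ j ∈ S, (∑ k ∈ Finset.range n, t (f k) j) ^ 2
      = ∑ k ∈ Finset.range n, ∑ l ∈ Finset.range n, ∑ j ∈ S, t (f k) j * t (f l) j := by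
        simp only [pow_two, Finset.sum_mul_sum]
        rw [Finset.sum_comm]
        exact Finset.sum_congr rfl fun k _ => Finset.sum_comm
    _ ≤ ∑ k ∈ Finset.range n, ∑ l ∈ Finset.range n, (η + if k = l then C ^ 2 else 0) :=
        Finset.sum_le_sum fun k _ => Finset.sum_le_sum fun l _ => hcross k l
    _ ≤ ∑ k ∈ Finset.range n, (n * η + C ^ 2) := by
        refine Finset.sum_le_sum fun k hk => ?_
        rw [Finset.sum_add_distrib, Finset.sum_ite_eq, if_pos hk]
        simp
    _ = n * C ^ 2 + (n : ℝ) ^ 2 * η := by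
        rw [Finset.sum_const, Finset.card_range, nsmul_eq_mul]
        ring

/-! ### Exclusion of `ℓ_1` -/

theorem inv_mSeq_succ_le (j : ℕ) : (mSeq (j + 1) : ℝ)⁻¹ ≤ 1 / 16 * (1 / 2) ^ j := by
  have h : j + 4 ≤ 5 ^ (j + 1) := by
    have : j < 5 ^ j := Nat.lt_pow_self (by norm_num)
    rw [pow_succ]
    lia
  rw [mSeq]
  push_cast
  calc ((2 : ℝ) ^ 5 ^ (j + 1))⁻¹ ≤ (2 ^ (j + 4))⁻¹ :=
        inv_anti₀ (by positivity) (pow_le_pow_right₀ (by norm_num) h)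
    _ = 1 / 16 * (1 / 2) ^ j := by rw [pow_add, mul_inv, one_div_pow]; ring

/-- The plain average of `n` well chosen blocks works: low and high indices contribute at most `C /
4` each, and `G` contributes at most `C / 2` by convexity. -/
theorem exists_average_le {G K : Set (ℕ →₀ ℝ)} (hK : IsFullyClosed G K)
    (hGI : ClosedUnderIntervals G) (hmin : K ⊆ fullClosure G) (hb : ∀ φ ∈ K, ∀ n, |φ n| ≤ 1)
    {w : ℕ → ℕ →₀ ℝ} (hw : IsBlockSequence w) {C : ℝ} (hC : 0 < C)
    (hwK : ∀ k, normingSeminorm K (w k) ≤ C) (hwG : ∀ k, normingSeminorm G (w k) ≤ C / 2) :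
    ∃ n : ℕ, ∀ N : ℕ, ∃ (F : Finset ℕ) (a : ℕ → ℝ), F.card ≤ n ∧ (∀ k ∈ F, N ≤ k) ∧
      ∑ k ∈ F, |a k| = 1 ∧ normingSeminorm K (∑ k ∈ F, a k • w k) ≤ C / 2 := by
  set t : ℕ → ℕ → ℝ := fun k j => weightedNorm K (j + 1) (w k) with ht
  have ht2 : ∀ k, ∀ S : Finset ℕ, ∑ j ∈ S, t k j ^ 2 ≤ C ^ 2 := by
    intro k S
    have h1 := sum_sq_weightedNorm_le hb hK.symm hK.l2 (w k) (S := S.map (addRightEmbedding 1))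
      (by
        intro j hj
        obtain ⟨i, -, rfl⟩ := Finset.mem_map.1 hj
        exact Nat.le_add_left 1 i)
    rw [Finset.sum_map] at h1
    exact h1.trans (pow_le_pow_left₀ (apply_nonneg _ _) (hwK k) 2)
  obtain ⟨J, hJ⟩ := exists_almost_orthogonal hC ht2 (η := C ^ 2 / 64) (by positivity)
  -- The sum makes the blocks split by low indices at most a fraction `1/8`. From `n ≥ 22` follows
  -- `n C² + n² C² / 64 ≤ (n C / 4)²`, needed for the high indices.
  set n := 8 * ∑ j ∈ Finset.range J, nSeq (j + 1) + 22 with hn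
  have hn0 : (0 : ℝ) < n := by rw [hn]; positivity
  refine ⟨n, fun N => ?_⟩
  obtain ⟨F, hFn, hFN, hFS⟩ := hJ n N
  refine ⟨F, fun _ => (n : ℝ)⁻¹, hFn.le, hFN, ?_, ?_⟩
  · rw [Finset.sum_const, hFn, nsmul_eq_mul, abs_of_pos (inv_pos.2 hn0), mul_inv_cancel₀ hn0.ne']
  refine normingSeminorm_le_of_l2Combinations hK hGI hmin hb ?_ ?_
  · rw [← Finset.smul_sum, map_smul_eq_mul, Real.norm_of_nonneg (inv_nonneg.2 hn0.le),
      inv_mul_le_iff₀ hn0]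
    calc normingSeminorm G (∑ k ∈ F, w k) ≤ ∑ k ∈ F, normingSeminorm G (w k) :=
          Finset.le_sum_of_subadditive _ (map_zero _).le (map_add_le_add _) _ _
      _ ≤ ∑ k ∈ F, C / 2 := Finset.sum_le_sum fun k _ => hwG k
      _ = n * (C / 2) := by rw [Finset.sum_const, hFn, nsmul_eq_mul]
  intro d f j c hj hinj hf hc
  have hc' : ∑ i, (c i : ℝ) ^ 2 ≤ 1 := by exact_mod_cast hc
  have hc1 : ∀ i, |(c i : ℝ)| ≤ 1 := fun i => by
    rw [← sq_le_one_iff_abs_le_one]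
    exact (Finset.single_le_sum (f := fun i => (c i : ℝ) ^ 2) (fun i _ => sq_nonneg _)
      (Finset.mem_univ i)).trans hc'
  set u : Fin d → ℝ := fun i => ∑ k ∈ F, |pairing (f i) (w k)| with hu
  have hu0 : ∀ i, 0 ≤ u i := fun i => Finset.sum_nonneg fun _ _ => abs_nonneg _
  have hmain : |pairing (∑ i, (c i : ℝ) • f i) (∑ k ∈ F, w k)| ≤ ∑ i, |(c i : ℝ)| * u i := by
    rw [pairing_sum_smul]
    refine (Finset.abs_sum_le_sum_abs _ _).trans (Finset.sum_le_sum fun i _ => ?_)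
    rw [abs_mul, map_sum]
    exact mul_le_mul_of_nonneg_left (Finset.abs_sum_le_sum_abs _ _) (abs_nonneg _)
  have hinj' : Function.Injective fun i => j i - 1 := fun i k h => hinj (by
    have := hj i
    have := hj k
    simp only at h
    lia)
  have hsub : ∀ i, j i - 1 + 1 = j i := fun i => Nat.sub_add_cancel (hj i)
  have hlow : ∑ i with j i - 1 < J, |(c i : ℝ)| * u i ≤ n * (C / 4) := by
    calc ∑ i with j i - 1 < J, |(c i : ℝ)| * u i
        ≤ ∑ i with j i - 1 < J,
            C * (n * (mSeq (j i - 1 + 1) : ℝ)⁻¹ + nSeq (j i - 1 + 1)) := by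
          refine Finset.sum_le_sum fun i _ => ?_
          refine (mul_le_of_le_one_left (hu0 i) (hc1 i)).trans ?_
          rw [hsub, ← hFn]
          exact (hf i).2.sum_abs_pairing_le hb (hf i).1 hw hwK F
      _ = ∑ l ∈ (Finset.univ.filter fun i => j i - 1 < J).map ⟨fun i => j i - 1, hinj'⟩,
            C * (n * (mSeq (l + 1) : ℝ)⁻¹ + nSeq (l + 1)) := by
          rw [Finset.sum_map]
          rfl
      _ ≤ ∑ l ∈ Finset.range J, C * (n * (mSeq (l + 1) : ℝ)⁻¹ + nSeq (l + 1)) := by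
          refine Finset.sum_le_sum_of_subset_of_nonneg (fun l hl => ?_) fun l _ _ => by positivity
          obtain ⟨i, hi, rfl⟩ := Finset.mem_map.1 hl
          exact Finset.mem_range.2 (Finset.mem_filter.1 hi).2
      _ = C * (n * (∑ l ∈ Finset.range J, (mSeq (l + 1) : ℝ)⁻¹) +
            ∑ l ∈ Finset.range J, (nSeq (l + 1) : ℝ)) := by
          rw [← Finset.mul_sum, Finset.sum_add_distrib, ← Finset.mul_sum]
      _ ≤ C * (n * (1 / 8) + n * (1 / 8)) := by
          gcongr
          · refine (Finset.sum_le_sum fun l _ => inv_mSeq_succ_le l).trans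
              ((sum_mul_half_pow_le _ (by norm_num)).trans (by norm_num))
          · rw [hn]
            push_cast
            linarith
      _ = n * (C / 4) := by ring
  have hhigh : ∑ i with ¬ j i - 1 < J, |(c i : ℝ)| * u i ≤ n * (C / 4) := by
    set I := Finset.univ.filter fun i => ¬ j i - 1 < J with hI
    have h1 : ∑ i ∈ I, u i ^ 2 ≤ (n * (C / 4)) ^ 2 := by
      calc ∑ i ∈ I, u i ^ 2 ≤ ∑ i ∈ I, (∑ k ∈ F, t k (j i - 1)) ^ 2 := by
            refine Finset.sum_le_sum fun i _ => pow_le_pow_left₀ (hu0 i) ?_ 2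
            refine Finset.sum_le_sum fun k _ => ?_
            simp only [ht]
            rw [hsub]
            exact abs_pairing_le_weightedNorm hb (hf i).1 (hf i).2 _
        _ = ∑ l ∈ I.map ⟨fun i => j i - 1, hinj'⟩, (∑ k ∈ F, t k l) ^ 2 := by
            rw [Finset.sum_map]
            rfl
        _ ≤ n * C ^ 2 + (n : ℝ) ^ 2 * (C ^ 2 / 64) := by
            refine hFS _ fun l hl => ?_
            obtain ⟨i, hi, rfl⟩ := Finset.mem_map.1 hl
            exact not_lt.1 (Finset.mem_filter.1 hi).2
        _ ≤ (n * (C / 4)) ^ 2 := by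
            have h22 : (22 : ℝ) ≤ n := by exact_mod_cast Nat.le_add_left 22 _
            have h3 : 0 ≤ (n : ℝ) * C ^ 2 * (n - 22) := by
              have : (0 : ℝ) ≤ n - 22 := by linarith
              positivity
            nlinarith [mul_pos hn0 (pow_pos hC 2)]
    have h2 : ∑ i ∈ I, |(c i : ℝ)| ^ 2 ≤ 1 := by
      simp only [sq_abs]
      exact (Finset.sum_le_sum_of_subset_of_nonneg (Finset.subset_univ _)
        fun _ _ _ => sq_nonneg _).trans hc'
    refine le_of_abs_le (abs_le_of_sq_le_sq ?_ (by positivity))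
    calc (∑ i ∈ I, |(c i : ℝ)| * u i) ^ 2 ≤ (∑ i ∈ I, |(c i : ℝ)| ^ 2) * ∑ i ∈ I, u i ^ 2 :=
          Finset.sum_mul_sq_le_sq_mul_sq _ _ _
      _ ≤ 1 * (n * (C / 4)) ^ 2 :=
          mul_le_mul h2 h1 (Finset.sum_nonneg fun _ _ => sq_nonneg _) zero_le_one
      _ = _ := one_mul _
  rw [← Finset.smul_sum, map_smul, smul_eq_mul, abs_mul, abs_of_pos (inv_pos.2 hn0),
    inv_mul_le_iff₀ hn0]
  refine hmain.trans ?_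
  rw [← Finset.sum_filter_add_sum_filter_not _ fun i => j i - 1 < J]
  linarith

/-- The upper bound of a block sequence with a lower `ℓ_1` estimate can be halved. -/
theorem LowerEllOne.exists_half {G K : Set (ℕ →₀ ℝ)} (hK : IsFullyClosed G K)
    (hGI : ClosedUnderIntervals G) (hmin : K ⊆ fullClosure G) (hb : ∀ φ ∈ K, ∀ n, |φ n| ≤ 1)
    (hX : ¬ AdmitsEllSpreadingModel (NormingSpace G) 1) {w : ℕ → ℕ →₀ ℝ} (hw : IsBlockSequence w)
    {c C : ℝ} (hC : 0 < C) (hl : LowerEllOne K c w) (hwK : ∀ k, normingSeminorm K (w k) ≤ C) :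
    ∃ v, IsBlockSequence v ∧ LowerEllOne K c v ∧ ∀ k, normingSeminorm K (v k) ≤ C / 2 := by
  have hbG : ∀ φ ∈ G, ∀ n, |φ n| ≤ 1 := fun φ hφ => hb φ (hK.subset hφ)
  obtain ⟨n, hn⟩ := exists_small_combination hbG hGI hX hw (half_pos hC)
    fun k => (normingSeminorm_mono hb hK.subset _).trans (hwK k)
  obtain ⟨v, hv, hlv, hvQ⟩ := hl.exists_blocks hw
    (Q := fun x => normingSeminorm K x ≤ C ∧ normingSeminorm G x ≤ C / 2) (n := n) fun N => by
      obtain ⟨F, a, hF, hFN, ha, hQ⟩ := hn N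
      refine ⟨F, a, hF, hFN, ha, ?_, hQ⟩
      calc normingSeminorm K (∑ k ∈ F, a k • w k)
          ≤ ∑ k ∈ F, normingSeminorm K (a k • w k) :=
            Finset.le_sum_of_subadditive _ (map_zero _).le (map_add_le_add _) _ _
        _ ≤ ∑ k ∈ F, |a k| * C := Finset.sum_le_sum fun k _ => by
            rw [map_smul_eq_mul, Real.norm_eq_abs]
            exact mul_le_mul_of_nonneg_left (hwK k) (abs_nonneg _)
        _ = C := by rw [← Finset.sum_mul, ha, one_mul]
  obtain ⟨m, hm⟩ := exists_average_le hK hGI hmin hb hv hC (fun k => (hvQ k).1)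
    fun k => (hvQ k).2
  exact hlv.exists_blocks hv (Q := fun x => normingSeminorm K x ≤ C / 2) hm

/-- Repeated halving leaves `c` unchanged and brings the upper bound below `c`, against the estimate
on a singleton. -/
theorem not_lowerEllOne {G K : Set (ℕ →₀ ℝ)} (hK : IsFullyClosed G K)
    (hGI : ClosedUnderIntervals G) (hmin : K ⊆ fullClosure G) (hb : ∀ φ ∈ K, ∀ n, |φ n| ≤ 1)
    (hX : ¬ AdmitsEllSpreadingModel (NormingSpace G) 1) {w : ℕ → ℕ →₀ ℝ} (hw : IsBlockSequence w)
    {c C : ℝ} (hc : 0 < c) (hC : 0 < C) (hwK : ∀ k, normingSeminorm K (w k) ≤ C) :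
    ¬ LowerEllOne K c w := by
  intro hl
  have hiter : ∀ r : ℕ, ∃ v, IsBlockSequence v ∧ LowerEllOne K c v ∧
      ∀ k, normingSeminorm K (v k) ≤ C * (1 / 2) ^ r := by
    intro r
    induction r with
    | zero => exact ⟨w, hw, hl, by simpa using hwK⟩
    | succ r ih =>
      obtain ⟨v, hv, hlv, hvC⟩ := ih
      obtain ⟨v', hv', hlv', hvC'⟩ := hlv.exists_half hK hGI hmin hb hX hv (by positivity) hvC
      refine ⟨v', hv', hlv', fun k => (hvC' k).trans_eq ?_⟩
      rw [pow_succ]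
      ring
  obtain ⟨r, hr⟩ := exists_pow_lt_of_lt_one (div_pos hc hC) (by norm_num : (1 / 2 : ℝ) < 1)
  obtain ⟨v, -, hlv, hvC⟩ := hiter r
  have h1 : c ≤ normingSeminorm K (v 0) := by
    simpa using hlv {0} (by intro i hi; simp) fun _ => 1
  rw [lt_div_iff₀ hC] at hr
  linarith [hvC 0]

/-- Differences double the coefficient sum, so they have lower constant `2 C⁻¹`. The approximation
by blocks costs `C⁻¹` of it, and the rest contradicts `not_lowerEllOne`. -/
theorem not_generatesSpreadingModel_one {G K : Set (ℕ →₀ ℝ)} (hK : IsFullyClosed G K)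
    (hGI : ClosedUnderIntervals G) (hmin : K ⊆ fullClosure G) (hb : ∀ φ ∈ K, ∀ n, |φ n| ≤ 1)
    (hbasis : ∀ n, Finsupp.single n 1 ∈ K)
    (hX : ¬ AdmitsEllSpreadingModel (NormingSpace G) 1) (x : ℕ → NormingSpace K) :
    ¬ GeneratesSpreadingModel 1 x := by
  classical
  intro hx
  obtain ⟨C, hC, hest⟩ := hx.estimates
  have hC0 : 0 < C := by linarith
  obtain ⟨i, i', w, hw, hi, hii, hil, hnear⟩ :=
    exists_blockSequence_near_differences hb hbasis (fun i => (hx.1 i).le)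
      (ε := C⁻¹) (by positivity)
  have hnear' : ∀ k, ‖toNormingSpace K (w k) - (x (i k) - x (i' k))‖ ≤ C⁻¹ := fun k =>
    (hnear k).trans (mul_le_of_le_one_right (by positivity)
      (pow_le_one₀ (by norm_num) (by norm_num)))
  have himono : StrictMono i := fun k l hkl => (hii k).trans (hil k l hkl)
  have himono' : StrictMono i' := fun k l hkl => (hil k l hkl).trans (hii l)
  have hne : ∀ k l, i k ≠ i' l := by
    intro k l h
    rcases lt_trichotomy k l with hkl | rfl | hkl
    · exact absurd h ((himono hkl).trans (hii l)).ne
    · exact absurd h (hii k).ne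
    · exact absurd h (hil l k hkl).ne'
  refine not_lowerEllOne hK hGI hmin hb hX hw (c := C⁻¹) (C := 3) (by positivity) (by norm_num)
    (fun k => ?_) fun F hF a => ?_
  · rw [← norm_toNormingSpace]
    have h1 := norm_add_le (toNormingSpace K (w k) - (x (i k) - x (i' k))) (x (i k) - x (i' k))
    rw [sub_add_cancel] at h1
    have h2 := norm_sub_le (x (i k)) (x (i' k))
    rw [hx.1, hx.1] at h2
    have h3 := hnear' k
    have h4 := inv_le_one_of_one_le₀ hC
    linarith
  · set F₁ := F.map ⟨i, himono.injective⟩ with hF₁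
    set F₂ := F.map ⟨i', himono'.injective⟩ with hF₂
    have hdisj : Disjoint F₁ F₂ := by
      refine Finset.disjoint_left.2 fun n hn hn' => ?_
      obtain ⟨k, -, rfl⟩ := Finset.mem_map.1 hn
      obtain ⟨l, -, h⟩ := Finset.mem_map.1 hn'
      exact hne k l h.symm
    -- From `#F ≤ k + 1` and `2 k + 1 ≤ i k` one gets `2 #F ≤ i k + 1`.
    have hS : F₁ ∪ F₂ ∈ schreier := by
      intro n hn
      have hcard : (F₁ ∪ F₂).card = 2 * F.card := by
        rw [Finset.card_union_of_disjoint hdisj, Finset.card_map, Finset.card_map, two_mul]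
      rw [hcard]
      have hk : ∃ k ∈ F, i k ≤ n := by
        rcases Finset.mem_union.1 hn with h | h
        · obtain ⟨k, hk, rfl⟩ := Finset.mem_map.1 h
          exact ⟨k, hk, le_rfl⟩
        · obtain ⟨k, hk, rfl⟩ := Finset.mem_map.1 h
          exact ⟨k, hk, (hii k).le⟩
      obtain ⟨k, hk, hkn⟩ := hk
      have h1 := hF k hk
      have h2 := hi k
      lia
    set b : ℕ → ℝ := fun n => if n ∈ F₁ then Function.extend i a 0 n else -Function.extend i' a 0 n
      with hb'
    have hb₁ : ∀ k ∈ F, b (i k) = a k := fun k hk => by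
      have : i k ∈ F₁ := Finset.mem_map.2 ⟨k, hk, rfl⟩
      simp only [hb', this, if_true]
      exact himono.injective.extend_apply _ _ _
    have hb₂ : ∀ k ∈ F, b (i' k) = -a k := fun k hk => by
      have : i' k ∉ F₁ := Finset.disjoint_right.1 hdisj (Finset.mem_map.2 ⟨k, hk, rfl⟩)
      simp only [hb', this, if_false]
      rw [himono'.injective.extend_apply]
    have key := (hest _ hS b).1
    rw [PiLp.norm_eq_of_L1] at key
    simp only [Real.norm_eq_abs] at key
    rw [Finset.sum_coe_sort (F₁ ∪ F₂) fun n => |b n|, Finset.sum_union hdisj,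
      Finset.sum_union hdisj] at key
    simp only [hF₁, hF₂, Finset.sum_map, Function.Embedding.coeFn_mk] at key
    have hs₁ : ∑ k ∈ F, |b (i k)| = ∑ k ∈ F, |a k| :=
      Finset.sum_congr rfl fun k hk => by rw [hb₁ k hk]
    have hs₂ : ∑ k ∈ F, |b (i' k)| = ∑ k ∈ F, |a k| :=
      Finset.sum_congr rfl fun k hk => by rw [hb₂ k hk, abs_neg]
    have hv₁ : ∑ k ∈ F, b (i k) • x (i k) = ∑ k ∈ F, a k • x (i k) :=
      Finset.sum_congr rfl fun k hk => by rw [hb₁ k hk]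
    have hv₂ : ∑ k ∈ F, b (i' k) • x (i' k) = ∑ k ∈ F, -(a k • x (i' k)) :=
      Finset.sum_congr rfl fun k hk => by rw [hb₂ k hk, neg_smul]
    rw [hs₁, hs₂, hv₁, hv₂, ← Finset.sum_add_distrib (f := fun k => a k • x (i k))] at key
    have herr : ‖∑ k ∈ F, a k • (toNormingSpace K (w k) - (x (i k) - x (i' k)))‖ ≤
        C⁻¹ * ∑ k ∈ F, |a k| := by
      rw [Finset.mul_sum]
      refine norm_sum_le_of_le _ fun k _ => ?_
      rw [norm_smul, Real.norm_eq_abs, mul_comm]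
      exact mul_le_mul_of_nonneg_right (hnear' k) (abs_nonneg _)
    have hsplit : ∑ k ∈ F, (a k • x (i k) + -(a k • x (i' k))) =
        toNormingSpace K (∑ k ∈ F, a k • w k) -
          ∑ k ∈ F, a k • (toNormingSpace K (w k) - (x (i k) - x (i' k))) := by
      rw [map_sum, ← Finset.sum_sub_distrib]
      refine Finset.sum_congr rfl fun k _ => ?_
      rw [map_smul, smul_sub, smul_sub]
      abel
    rw [hsplit] at key
    have h1 := key.trans (norm_sub_le _ _)
    rw [norm_toNormingSpace] at h1
    linarith

end SpreadingModels

end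

open SpreadingModels in
theorem theorem11p3 (G : Set (ℕ →₀ ℝ)) (hG : IsGroundSet G)
    (hX : ¬ AdmitsEllSpreadingModel (NormingSpace G) 1)
    (D : Set (ℕ →₀ ℝ)) (hD : IsExtension G D) :
    (∀ p : ENNReal, 1 ≤ p → p ≠ ⊤ → ¬ AdmitsEllSpreadingModel (NormingSpace D) p) ∧
      ¬ AdmitsC0SpreadingModel (NormingSpace D) := by
  have hK := hD.isFullyClosed
  have hb : ∀ φ ∈ D, ∀ n, |φ n| ≤ 1 := fun φ hφ =>
    hG.abs_le_one_of_mem_fullClosure φ (hD.subset_fullClosure hφ)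
  have hbasis : ∀ n, Finsupp.single n 1 ∈ D := fun n => hD.subset (hG.basis_mem n)
  refine ⟨fun p hp _ => ?_, ?_⟩
  · rintro ⟨x, hx⟩
    rcases hp.eq_or_lt with rfl | hp
    · exact not_generatesSpreadingModel_one hK hG.interval hD.subset_fullClosure hb hbasis hX x hx
    · exact not_generatesSpreadingModel_of_one_lt hb hbasis hD.symm hD.interval hK.operation hp x hx
  · rintro ⟨x, hx⟩
    exact not_generatesSpreadingModel_of_one_lt hb hbasis hD.symm hD.interval hK.operation
      ENNReal.one_lt_top x hx
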